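/- **Setting.** Let $G$ be a compact group (e.g. a compact Lie group). Realize $S^3$ as a PL sphere with a base point $\infty$. *Topspin networks.* A topspin network $\psi=(\Gamma,\rho,\iota,\sigma)$ consists of a finite oriented graph $\Gamma\subset S^3\smallsetminus\{\infty\}$ with PL edges (closed arcs meeting only in end points), a finite-dimensional unitary representation $\rho_e$ of $G$ for each edge $e$, an intertwiner $\iota_v:\bigotimes_{e\text{ into }v}\rho_e\to\bigotimes_{e\text{ out of }v}\rho_e$ for each vertex $v$, and a homomorphism $\sigma:\pi_1(S^3\smallsetminus\Gamma,\infty)\to S_n$. *Topspin foams.* A topspin foam $\Psi=(\Sigma,\tilde\rho,\tilde\iota,\tilde\sigma):\psi_0\to\psi_1$ (same $n$) consists of the following. (a) A finite oriented polygonal two-complex $\Sigma$, PL embedded in $S^3\times[0,1]$ away from $\{\infty\}\times[0,1]$, which meets $S^3\times\{0\}$ in $\Gamma_0$ and $S^3\times\{1\}$ in $\Gamma_1$ and is, cell by cell, the product $\Gamma_0\times[0,\varepsilon)$, resp. $\Gamma_1\times(1-\varepsilon,1]$, near them. Write $f_e$ for the face that is $e\times[0,\varepsilon)$ (resp. $e\times(1-\varepsilon,1]$)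 and $e_v$ for the edge that is $v\times[0,\varepsilon)$ (resp. $v\times(1-\varepsilon,1]$) there. (b) A representation $\tilde\rho_f$ for each face, and an intertwiner $\tilde\iota_e:\bigotimes_{e\in\partial f}\tilde\rho_f\to\bigotimes_{\bar e\in\partial f}\tilde\rho_f$ for each edge $e$ not in $\Gamma_0\cup\Gamma_1$. Along the boundary, $\tilde\rho_{f_e}$ is $\rho_e$ or its dual $\rho_e^*$ and $\tilde\iota_{e_v}$ is $\iota_v$, suitably dualized, according to the orientations of $f_e$ and $e_v$. (c) A homomorphism $\tilde\sigma:\pi_1((S^3\times[0,1])\smallsetminus\Sigma)\to S_n$ that restricts to $\sigma_0$ and $\sigma_1$ at the two ends (base points being joined along $\{\infty\}\times[0,1]$). *Gluing.* $\Psi=\Psi_1\cup_\psi\Psi_2$, for $\Psi_1:\psi_0\to\psi$, $\Psi_2:\psi\to\psi_2$, is obtained by stacking $S^3\times[0,1]$ twice and rescaling. For each edge $e$ of $\Gamma$ the faces $f_e$ of $\Sigma_1$ and $\Sigma_2$ together form one face, and for each vertex $v$ of $\Gamma$ the edges $e_v$ form one edge; the remaining cells are the cells of $\Sigma_1$ and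 $\Sigma_2$ not meeting $\Gamma$. Orientations, labels and monodromy of $\Psi$ restrict to those of $\Psi_1$ and $\Psi_2$. *The algebra.* Two foams $\psi_0\to\psi_1$ are equivalent if a PL homeomorphism of $S^3\times[0,1]$, the identity on $S^3\times\{0,1\}$ and preserving $\{\infty\}\times[0,1]$, carries one to the other with all data. $\mathcal S$ is the semigroupoid of topspin networks and equivalence classes of topspin foams (all $n$), with composition $\Psi_1\Psi_2$ by gluing, and $\mathbb C[\mathcal S]$ is the space of finitely supported functions on its arrows with $(f_1\star f_2)(\Psi)=\sum_{\Psi=\Psi_1\Psi_2}f_1(\Psi_1)f_2(\Psi_2)$. *Amplitudes.* A spin foam model gives complex amplitudes $\mathbb A_f(\tilde\rho_f)$, $\mathbb A_e(\tilde\rho_{F(e)},\tilde\iota_e)$, $\mathbb A_v(\tilde\rho_{F(v)},\tilde\iota_{E(v)})$ depending only on the labels (and incidences) at the cell, and a weight $\omega(\Sigma)$ depending only on the embedded two-complex up to PL homeomorphisms as above. Put $$\mathbb A(\Psi)=\omega(\Sigma)\prod_f\mathbb A_f(\tilde\rho_f)\prod_e\mathbb A_e(\tilde\rho_{F(e)},\tilde\iota_e)\prod_v\mathbb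 A_v(\tilde\rho_{F(v)},\tilde\iota_{E(v)}),$$ over all faces of $\Sigma$ and the edges and vertices not in $\Gamma_0\cup\Gamma_1$. For $\Psi:\psi_0\to\psi_1$ put $\mathbb A(\psi_0)=\prod_{e\in E(\Gamma_0)}\mathbb A_{f_e}\prod_{v\in V(\Gamma_0)}\mathbb A_{e_v}$, with the amplitudes of the cells $f_e=e\times[0,1]$, $e_v=v\times[0,1]$ of the product foam on $\Gamma_0\times[0,1]$ (oriented as $\Sigma$ is near $\Gamma_0$), and $\mathbb A^0(\Psi)=\mathbb A(\Psi)/\mathbb A(\psi_0)$. **Lemma.** Suppose that $\omega(\Sigma_1\cup_\Gamma\Sigma_2)=\omega(\Sigma_1)\,\omega(\Sigma_2)$ for all gluings of two-complexes along a boundary graph. 1. If $\Psi=\Psi_1\cup_\psi\Psi_2$ and the normalizing amplitudes of the sources of $\Psi_1$ and $\Psi_2$ are nonzero, then $\mathbb A^0(\Psi)=\mathbb A^0(\Psi_1)\,\mathbb A^0(\Psi_2)$. 2. If the amplitudes $\mathbb A(\Psi)$ and $\mathbb A(\psi_0)$ are positive real numbers for all topspin foams $\Psi:\psi_0\to\psi_1$,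 then $$\sigma_t(f)(\Psi)=\mathbb A^0(\Psi)^{\mathrm i t}f(\Psi)$$ is well defined on equivalence classes and defines a time evolution on $\mathbb C[\mathcal S]$: the $\sigma_t$, $t\in\mathbb R$, are linear and preserve $\mathbb C[\mathcal S]$, $\sigma_0=\mathrm{id}$, $\sigma_{s+t}=\sigma_s\sigma_t$, $\sigma_t(f_1\star f_2)=\sigma_t(f_1)\star\sigma_t(f_2)$ for $f_1,f_2\in\mathbb C[\mathcal S]$, and $t\mapsto\sigma_t(f)(\Psi)$ is continuous. -/

import Mathlib

noncomputable section

namespace SpinFoam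

/-! ### Piecewise-linear conventions -/

section PL

variable {E E' : Type*} [AddCommGroup E] [Module ℝ E] [AddCommGroup E'] [Module ℝ E']

/-- A compact polyhedron: a finite union of convex hulls of finite sets. -/
def IsPolyhedron (s : Set E) : Prop :=
  ∃ T : Finset (Finset E), s = ⋃ t ∈ T, convexHull ℝ (t : Set E)

/-- A map is PL on the compact polyhedron `s` if its graph over `s` is a compact polyhedron. -/
def IsPLOn (h : E → E') (s : Set E) : Prop :=
  IsPolyhedron ((fun x => (x, h x)) '' s)

variable [TopologicalSpace E]

/-- `s` is an embedded PL arc, directed from `a` to `b`. -/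
def IsArc (s : Set E) (a b : E) : Prop :=
  IsPolyhedron s ∧ ∃ φ : unitInterval → E,
    Continuous φ ∧ Function.Injective φ ∧ Set.range φ = s ∧ φ 0 = a ∧ φ 1 = b

/-- `s` is an embedded PL disc with boundary circle `c`. -/
def IsDisc (s c : Set E) : Prop :=
  IsPolyhedron s ∧ ∃ φ : Metric.closedBall (0 : EuclideanSpace ℝ (Fin 2)) 1 → E,
    Continuous φ ∧ Function.Injective φ ∧ Set.range φ = s ∧
      φ '' {x | ‖(x : EuclideanSpace ℝ (Fin 2))‖ = 1} = c

end PL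

/-- The PL three-sphere, realized as the boundary of the cube `[-1, 1]⁴`
(the norm on `Fin 4 → ℝ` is the sup norm). -/
def S3 : Set (Fin 4 → ℝ) := Metric.sphere 0 1

/-- The vector space `ℝ⁴ × ℝ` that contains `S³ × [0, 1]`. -/
abbrev Amb : Type := (Fin 4 → ℝ) × ℝ

/-- The cylinder `S³ × [0, 1]`. -/
def Cyl : Set Amb := S3 ×ˢ Set.Icc 0 1

/-- The point at infinity of `S³`, used as base point of fundamental groups.  Embedded graphs
avoid it, and embedded two-complexes avoid the segment `{∞} × [0, 1]`. -/
def pt : Fin 4 → ℝ := fun _ => 1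

lemma pt_mem : pt ∈ S3 := by
  have h : (pt : Fin 4 → ℝ) = fun _ => 1 := rfl
  simp [S3, h, pi_norm_const]

/-! ### Embedded graphs -/

/-- A finite oriented graph embedded in `S³` with PL edges (closed arcs that meet only in
common end points, so that there are no loops; a closed curve has at least two vertices). -/
structure EmbeddedGraph where
  V : Finset (Fin 4 → ℝ)
  E : Finset (Set (Fin 4 → ℝ))
  src : E → V
  tgt : E → V
  isArc : ∀ e : E, IsArc (e : Set (Fin 4 → ℝ)) (src e) (tgt e)
  vert_sphere : ∀ v ∈ V, v ∈ S3 ∧ v ≠ pt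
  edge_sphere : ∀ e ∈ E, ∀ x ∈ e, x ∈ S3 ∧ x ≠ pt
  vert_edge : ∀ (v : V) (e : E), (v : Fin 4 → ℝ) ∈ (e : Set (Fin 4 → ℝ)) → v = src e ∨ v = tgt e
  edge_edge : ∀ e ∈ E, ∀ e' ∈ E, e ≠ e' → ∀ x ∈ e ∩ e', x ∈ V

namespace EmbeddedGraph

variable (Γ : EmbeddedGraph)

/-- The underlying set of the graph. -/
def carrier : Set (Fin 4 → ℝ) := (Γ.V : Set (Fin 4 → ℝ)) ∪ ⋃ e ∈ Γ.E, e

/-- The complement `S³ ∖ Γ`. -/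
abbrev Compl : Type := {x : Fin 4 → ℝ // x ∈ S3 ∧ x ∉ Γ.carrier}

lemma pt_notMem : pt ∉ Γ.carrier := by
  rintro (h | h)
  · exact (Γ.vert_sphere _ h).2 rfl
  · simp only [Set.mem_iUnion] at h
    obtain ⟨e, he, h⟩ := h
    exact (Γ.edge_sphere e he _ h).2 rfl

/-- The base point of `S³ ∖ Γ`. -/
def base : Γ.Compl := ⟨pt, pt_mem, Γ.pt_notMem⟩

/-- The edges incoming to or outgoing from a vertex. -/
abbrev Star (v : Γ.V) : Type := {e : Γ.E // Γ.src e = v ∨ Γ.tgt e = v}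

open scoped Classical in
/-- `1` for edges incoming to `v`, `-1` for edges outgoing from `v`. -/
def sgn (v : Γ.V) (e : Γ.Star v) : SignType := if Γ.tgt e.1 = v then 1 else -1

/-- A choice of orientation for each of the cells `e × [0, 1]` and `v × [0, 1]` of the product
`Γ × [0, 1]`; `false` is the product orientation (see `TwoComplex.srcOrientation`). -/
structure CollarOrientation where
  edge : Γ.E → Bool
  vert : Γ.V → Bool

end EmbeddedGraph

/-! ### Embedded two-complexes with boundary -/

/-- A finite oriented polygonal two-complex `Σ` embedded in `S³ × [0, 1]` with PL cells, bordered
by `Γ₀` in `S³ × {0}` and by `Γ₁` in `S³ × {1}`, near which it is a product (as a cell complex).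
Edges and faces are closed cells, `inc f e` is the coefficient of `e` in `∂ f`. -/
structure TwoComplex (Γ₀ Γ₁ : EmbeddedGraph) where
  V : Finset Amb
  E : Finset (Set Amb)
  F : Finset (Set Amb)
  src : E → V
  tgt : E → V
  inc : F → E → SignType
  isArc : ∀ e : E, IsArc (e : Set Amb) (src e) (tgt e)
  isDisc : ∀ f : F, IsDisc (f : Set Amb) (⋃ (e : E) (_ : inc f e ≠ 0), (e : Set Amb))
  -- the signs orient the boundary circle of each face: `∂ ∂ f = 0`
  bd_bd : ∀ (f : F) (v : V),
    ∑ e : E, (inc f e : ℤ) * (Set.indicator {e | tgt e = v} 1 e - Set.indicator {e | src e = v} 1 e)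
      = 0
  vert_cyl : ∀ v ∈ V, v ∈ Cyl ∧ v.1 ≠ pt
  edge_cyl : ∀ e ∈ E, ∀ p ∈ e, p ∈ Cyl ∧ p.1 ≠ pt
  face_cyl : ∀ f ∈ F, ∀ p ∈ f, p ∈ Cyl ∧ p.1 ≠ pt
  -- the open cells are pairwise disjoint
  vert_edge : ∀ (v : V) (e : E), (v : Amb) ∈ (e : Set Amb) → v = src e ∨ v = tgt e
  edge_edge : ∀ e ∈ E, ∀ e' ∈ E, e ≠ e' → ∀ p ∈ e ∩ e', p ∈ V
  vert_face : ∀ (v : V) (f : F), (v : Amb) ∈ (f : Set Amb) →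
    ∃ e : E, inc f e ≠ 0 ∧ (v : Amb) ∈ (e : Set Amb)
  edge_face : ∀ (e : E) (f : F), ∀ p ∈ (e : Set Amb) ∩ f,
    ∃ e' : E, inc f e' ≠ 0 ∧ p ∈ (e' : Set Amb)
  face_face : ∀ f f' : F, f ≠ f' → ∀ p ∈ (f : Set Amb) ∩ f',
    ∃ e : E, inc f e ≠ 0 ∧ p ∈ (e : Set Amb)
  -- the part of `Σ` in `S³ × {0}` is `Γ₀`, the part in `S³ × {1}` is `Γ₁`
  vert_bot : ∀ x, (x, 0) ∈ V ↔ x ∈ Γ₀.V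
  vert_top : ∀ x, (x, 1) ∈ V ↔ x ∈ Γ₁.V
  edge_bot : ∀ s : Set (Fin 4 → ℝ), s ×ˢ {0} ∈ E ↔ s ∈ Γ₀.E
  edge_top : ∀ s : Set (Fin 4 → ℝ), s ×ˢ {1} ∈ E ↔ s ∈ Γ₁.E
  src_bot : ∀ e : Γ₀.E, (src ⟨e.1 ×ˢ {0}, (edge_bot e).2 e.2⟩ : Amb) = (↑(Γ₀.src e), 0)
  tgt_bot : ∀ e : Γ₀.E, (tgt ⟨e.1 ×ˢ {0}, (edge_bot e).2 e.2⟩ : Amb) = (↑(Γ₀.tgt e), 0)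
  src_top : ∀ e : Γ₁.E, (src ⟨e.1 ×ˢ {1}, (edge_top e).2 e.2⟩ : Amb) = (↑(Γ₁.src e), 1)
  tgt_top : ∀ e : Γ₁.E, (tgt ⟨e.1 ×ˢ {1}, (edge_top e).2 e.2⟩ : Amb) = (↑(Γ₁.tgt e), 1)
  -- `srcFace e` is the face `f_e` that is `e × [0, ε)` near the boundary,
  -- `srcEdge v` is the edge `e_v` that is `v × [0, ε)` near the boundary
  srcFace : Γ₀.E → F
  srcEdge : Γ₀.V → E
  tgtFace : Γ₁.E → F
  tgtEdge : Γ₁.V → E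
  -- `Σ ∩ (S³ × [0, ε)) = Γ₀ × [0, ε)`, cell by cell
  collar_bot : ∃ ε : ℝ, 0 < ε ∧ ε ≤ 1 ∧
    (∀ e, (srcFace e : Set Amb) ∩ {p | p.2 < ε} = e.1 ×ˢ Set.Ico 0 ε) ∧
    (∀ v, (srcEdge v : Set Amb) ∩ {p | p.2 < ε} = {v.1} ×ˢ Set.Ico 0 ε) ∧
    (∀ f : F, (∃ e, f = srcFace e) ∨ ∀ p ∈ (f : Set Amb), ε ≤ p.2) ∧
    (∀ e : E, (∃ v, e = srcEdge v) ∨ (∃ s ∈ Γ₀.E, (e : Set Amb) = s ×ˢ {0}) ∨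
      ∀ p ∈ (e : Set Amb), ε ≤ p.2) ∧
    (∀ v ∈ V, v.2 = 0 ∨ ε ≤ v.2)
  -- `Σ ∩ (S³ × (1 - ε, 1]) = Γ₁ × (1 - ε, 1]`, cell by cell
  collar_top : ∃ ε : ℝ, 0 < ε ∧ ε ≤ 1 ∧
    (∀ e, (tgtFace e : Set Amb) ∩ {p | 1 - ε < p.2} = e.1 ×ˢ Set.Ioc (1 - ε) 1) ∧
    (∀ v, (tgtEdge v : Set Amb) ∩ {p | 1 - ε < p.2} = {v.1} ×ˢ Set.Ioc (1 - ε) 1) ∧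
    (∀ f : F, (∃ e, f = tgtFace e) ∨ ∀ p ∈ (f : Set Amb), p.2 ≤ 1 - ε) ∧
    (∀ e : E, (∃ v, e = tgtEdge v) ∨ (∃ s ∈ Γ₁.E, (e : Set Amb) = s ×ˢ {1}) ∨
      ∀ p ∈ (e : Set Amb), p.2 ≤ 1 - ε) ∧
    (∀ v ∈ V, v.2 = 1 ∨ v.2 ≤ 1 - ε)

namespace TwoComplex

variable {Γ₀ Γ₁ Γ₂ : EmbeddedGraph} (C : TwoComplex Γ₀ Γ₁)

/-- The underlying set of the two-complex. -/
def carrier : Set Amb := (C.V : Set Amb) ∪ (⋃ e ∈ C.E, e) ∪ ⋃ f ∈ C.F, f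

/-- The complement `(S³ × [0, 1]) ∖ Σ`. -/
abbrev Compl : Type := {p : Amb // p ∈ Cyl ∧ p ∉ C.carrier}

lemma pt_notMem (t : ℝ) : (pt, t) ∉ C.carrier := by
  rintro ((h | h) | h)
  · exact (C.vert_cyl _ h).2 rfl
  · simp only [Set.mem_iUnion] at h
    obtain ⟨e, he, h⟩ := h
    exact (C.edge_cyl e he _ h).2 rfl
  · simp only [Set.mem_iUnion] at h
    obtain ⟨e, he, h⟩ := h
    exact (C.face_cyl e he _ h).2 rfl

/-- The point `(∞, t)` of the complement. -/
def basePt (t : unitInterval) : C.Compl := ⟨(pt, t), ⟨pt_mem, t.2⟩, C.pt_notMem t⟩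

/-- The vertical path from `(∞, 0)` to `(∞, t)`. -/
def vertical (t : unitInterval) : Path (C.basePt 0) (C.basePt t) where
  toFun s := C.basePt (s * t)
  continuous_toFun := by
    unfold basePt
    fun_prop
  source' := by simp
  target' := by simp

/-- The edges of `Σ` that do not lie in `Γ₀` or `Γ₁`. -/
abbrev IntEdge : Type :=
  {e : C.E // ¬ (e : Set Amb) ⊆ {p | p.2 = 0} ∧ ¬ (e : Set Amb) ⊆ {p | p.2 = 1}}

/-- The vertices of `Σ` that do not lie in `Γ₀` or `Γ₁`. -/
abbrev IntVert : Type := {v : C.V // v.1.2 ≠ 0 ∧ v.1.2 ≠ 1}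

/-- The faces `f` adjacent to an edge `e`, i.e. with `e ∈ ∂ f` or `ē ∈ ∂ f`. -/
abbrev Star (e : C.E) : Type := {f : C.F // C.inc f e ≠ 0}

lemma srcEdge_int (v : Γ₀.V) : ¬ (C.srcEdge v : Set Amb) ⊆ {p | p.2 = 0} ∧
    ¬ (C.srcEdge v : Set Amb) ⊆ {p | p.2 = 1} := by
  obtain ⟨ε, h0, h1, -, h, -⟩ := C.collar_bot
  have key : ∀ t, 0 ≤ t → t < ε → ((v.1, t) : Amb) ∈ (C.srcEdge v : Set Amb) := fun t ht ht' => by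
    have : ((v.1, t) : Amb) ∈ (C.srcEdge v : Set Amb) ∩ {p | p.2 < ε} := by
      rw [h v]; exact ⟨rfl, ht, ht'⟩
    exact this.1
  refine ⟨fun hs => ?_, fun hs => ?_⟩
  · have := hs (key (ε / 2) (by linarith) (by linarith))
    simp only [Set.mem_ofPred_eq] at this
    linarith
  · have := hs (key 0 le_rfl h0)
    simp at this

lemma tgtEdge_int (v : Γ₁.V) : ¬ (C.tgtEdge v : Set Amb) ⊆ {p | p.2 = 0} ∧
    ¬ (C.tgtEdge v : Set Amb) ⊆ {p | p.2 = 1} := by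
  obtain ⟨ε, h0, h1, -, h, -⟩ := C.collar_top
  have key : ∀ t, 1 - ε < t → t ≤ 1 → ((v.1, t) : Amb) ∈ (C.tgtEdge v : Set Amb) :=
    fun t ht ht' => by
      have : ((v.1, t) : Amb) ∈ (C.tgtEdge v : Set Amb) ∩ {p | 1 - ε < p.2} := by
        rw [h v]; exact ⟨rfl, ht, ht'⟩
      exact this.1
  refine ⟨fun hs => ?_, fun hs => ?_⟩
  · have := hs (key 1 (by linarith) le_rfl)
    simp at this
  · have := hs (key (1 - ε / 2) (by linarith) (by linarith))
    simp only [Set.mem_ofPred_eq] at this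
    linarith

open scoped Classical in
/-- The orientation of the cells `f_e`, `e_v` of `Σ` along `Γ₀`.  In the product orientation
`ē ∈ ∂ f_e`, and `e_v` ends at `v`, so that `e_v ∈ ∂ f_e` exactly when `e` is incoming to `v`. -/
def srcOrientation : Γ₀.CollarOrientation where
  edge e := decide (C.inc (C.srcFace e) ⟨e.1 ×ˢ {0}, (C.edge_bot e).2 e.2⟩ = 1)
  vert v := decide ((C.src (C.srcEdge v) : Amb) = (v.1, 0))

open scoped Classical in
/-- The orientation of the cells `f_e`, `e_v` of `Σ` along `Γ₁`.  In the product orientation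
`e ∈ ∂ f_e`, and `e_v` starts at `v`. -/
def tgtOrientation : Γ₁.CollarOrientation where
  edge e := decide (C.inc (C.tgtFace e) ⟨e.1 ×ˢ {1}, (C.edge_top e).2 e.2⟩ = -1)
  vert v := decide ((C.tgt (C.tgtEdge v) : Amb) = (v.1, 1))

/-- `h` is a PL homeomorphism of `S³ × [0, 1]`, the identity on `S³ × {0, 1}` and preserving
`{∞} × [0, 1]`, that carries the two-complex `C` onto `C'`, cell by cell. -/
structure IsIsoVia (h : Amb → Amb) (C C' : TwoComplex Γ₀ Γ₁) : Prop where
  bijOn : Set.BijOn h Cyl Cyl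
  isPL : IsPLOn h Cyl
  bot : ∀ x ∈ S3, h (x, 0) = (x, 0)
  top : ∀ x ∈ S3, h (x, 1) = (x, 1)
  line : ∀ t ∈ Set.Icc (0 : ℝ) 1, (h (pt, t)).1 = pt
  verts : (C'.V : Set Amb) = h '' C.V
  edges : (C'.E : Set (Set Amb)) = (fun e => h '' e) '' C.E
  faces : (C'.F : Set (Set Amb)) = (fun f => h '' f) '' C.F
  src : ∀ (e : C.E) (e' : C'.E), (e' : Set Amb) = h '' e → (C'.src e' : Amb) = h (C.src e)
  tgt : ∀ (e : C.E) (e' : C'.E), (e' : Set Amb) = h '' e → (C'.tgt e' : Amb) = h (C.tgt e)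
  inc : ∀ (f : C.F) (f' : C'.F) (e : C.E) (e' : C'.E),
    (f' : Set Amb) = h '' f → (e' : Set Amb) = h '' e → C'.inc f' e' = C.inc f e
  srcFace : ∀ e, (C'.srcFace e : Set Amb) = h '' C.srcFace e
  srcEdge : ∀ v, (C'.srcEdge v : Set Amb) = h '' C.srcEdge v
  tgtFace : ∀ e, (C'.tgtFace e : Set Amb) = h '' C.tgtFace e
  tgtEdge : ∀ v, (C'.tgtEdge v : Set Amb) = h '' C.tgtEdge v

end TwoComplex

/-- The embedding of `S³ × [0, 1]` as the lower half of `S³ × [0, 1]`. -/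
def lower (p : Amb) : Amb := (p.1, p.2 / 2)

/-- The embedding of `S³ × [0, 1]` as the upper half of `S³ × [0, 1]`. -/
def upper (p : Amb) : Amb := (p.1, (p.2 + 1) / 2)

/-- `C = C₁ ∪_Γ C₂` is obtained by placing `C₁` in the lower half and `C₂` in the upper half of
`S³ × [0, 1]` and gluing along the common boundary graph `Γ = Γ₁`.  Each edge `e` of `Γ` lies in
the face `f_e` of `C₁` and in the face `f_e` of `C₂`; these two are `e × (1/2 - ε, 1/2]` and
`e × [1/2, 1/2 + ε)` near `Γ` and together form one face of `C`.  In the same way the edges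
`e_v` of `C₁` and `C₂` form one edge of `C`.  All other cells of `C` are cells of `C₁` or `C₂` that
do not meet `Γ`.  Orientations of the cells of `C` restrict to those of `C₁` and `C₂`. -/
structure TwoComplex.IsGluing {Γ₀ Γ₁ Γ₂ : EmbeddedGraph} (C₁ : TwoComplex Γ₀ Γ₁)
    (C₂ : TwoComplex Γ₁ Γ₂) (C : TwoComplex Γ₀ Γ₂) : Prop where
  verts : ∀ v, v ∈ C.V ↔
    (∃ w ∈ C₁.V, w.2 ≠ 1 ∧ v = lower w) ∨ (∃ w ∈ C₂.V, w.2 ≠ 0 ∧ v = upper w)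
  edges : ∀ s, s ∈ C.E ↔
    (∃ e ∈ C₁.E, (∀ p ∈ e, p.2 ≠ 1) ∧ s = lower '' e) ∨
    (∃ e ∈ C₂.E, (∀ p ∈ e, p.2 ≠ 0) ∧ s = upper '' e) ∨
    (∃ v, s = lower '' C₁.tgtEdge v ∪ upper '' C₂.srcEdge v)
  faces : ∀ s, s ∈ C.F ↔
    (∃ f ∈ C₁.F, (∀ p ∈ f, p.2 ≠ 1) ∧ s = lower '' f) ∨
    (∃ f ∈ C₂.F, (∀ p ∈ f, p.2 ≠ 0) ∧ s = upper '' f) ∨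
    (∃ e, s = lower '' C₁.tgtFace e ∪ upper '' C₂.srcFace e)
  src₁ : ∀ (e : C₁.E) (c : C.E), lower '' e ⊆ c → (C₁.src e).1.2 ≠ 1 →
    (C.src c : Amb) = lower (C₁.src e)
  tgt₁ : ∀ (e : C₁.E) (c : C.E), lower '' e ⊆ c → (C₁.tgt e).1.2 ≠ 1 →
    (C.tgt c : Amb) = lower (C₁.tgt e)
  src₂ : ∀ (e : C₂.E) (c : C.E), upper '' e ⊆ c → (C₂.src e).1.2 ≠ 0 →
    (C.src c : Amb) = upper (C₂.src e)
  tgt₂ : ∀ (e : C₂.E) (c : C.E), upper '' e ⊆ c → (C₂.tgt e).1.2 ≠ 0 →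
    (C.tgt c : Amb) = upper (C₂.tgt e)
  inc₁ : ∀ (f : C₁.F) (g : C.F) (e : C₁.E) (c : C.E), lower '' f ⊆ g → lower '' e ⊆ c →
    C.inc g c = C₁.inc f e
  inc₂ : ∀ (f : C₂.F) (g : C.F) (e : C₂.E) (c : C.E), upper '' f ⊆ g → upper '' e ⊆ c →
    C.inc g c = C₂.inc f e
  srcFace : ∀ e, lower '' C₁.srcFace e ⊆ C.srcFace e
  srcEdge : ∀ v, lower '' C₁.srcEdge v ⊆ C.srcEdge v
  tgtFace : ∀ e, upper '' C₂.tgtFace e ⊆ C.tgtFace e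
  tgtEdge : ∀ v, upper '' C₂.tgtEdge v ⊆ C.tgtEdge v

/-! ### Representations and intertwiners -/

section Labels

variable {G : Type*} [Group G] [TopologicalSpace G]

variable (G) in
/-- A finite-dimensional continuous unitary representation, in an orthonormal basis. -/
structure URep where
  dim : ℕ
  hom : G →* Matrix.unitaryGroup (Fin dim) ℂ
  continuous_hom : Continuous fun g => (hom g : Matrix (Fin dim) (Fin dim) ℂ)

/-- The entrywise complex conjugate of a unitary matrix, which is the transpose of its inverse. -/
def conjUnitary (d : ℕ) : Matrix.unitaryGroup (Fin d) ℂ →* Matrix.unitaryGroup (Fin d) ℂ where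
  toFun A := ⟨(A : Matrix (Fin d) (Fin d) ℂ).map (starRingEnd ℂ), by
    have h := Matrix.mem_unitaryGroup_iff.1 A.2
    rw [Matrix.mem_unitaryGroup_iff]
    have h2 := congrArg (fun B : Matrix (Fin d) (Fin d) ℂ => B.map (starRingEnd ℂ)) h
    simpa [Matrix.map_mul, Matrix.star_eq_conjTranspose, Matrix.conjTranspose_map,
      Function.Semiconj, Function.comp_def, Matrix.conjTranspose, Matrix.transpose_map] using h2⟩
  map_one' := by
    apply Subtype.ext
    exact Matrix.map_one _ (map_zero _) (map_one _)
  map_mul' A B := by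
    apply Subtype.ext
    simp [Matrix.map_mul]

lemma conjUnitary_apply (d : ℕ) (A : Matrix.unitaryGroup (Fin d) ℂ) (i j : Fin d) :
    (conjUnitary d A : Matrix (Fin d) (Fin d) ℂ) i j =
      star ((A : Matrix (Fin d) (Fin d) ℂ) i j) := rfl

namespace URep

/-- `ρ` itself or its dual representation `ρ*`, in the dual basis. -/
def orient (ρ : URep G) (b : Bool) : URep G where
  dim := ρ.dim
  hom := bif b then (conjUnitary ρ.dim).comp ρ.hom else ρ.hom
  continuous_hom := by
    cases b
    · exact ρ.continuous_hom
    · refine continuous_matrix fun i j => ?_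
      exact Complex.continuous_conj.comp (ρ.continuous_hom.matrix_elem i j)

/-- The matrix entries of `ρ(g)` or, in an incoming tensor factor (`s = 1`), of its conjugate. -/
def slot (ρ : URep G) (s : SignType) (g : G) (i j : Fin ρ.dim) : ℂ :=
  if s = 1 then star ((ρ.hom g : Matrix (Fin ρ.dim) (Fin ρ.dim) ℂ) i j)
  else (ρ.hom g : Matrix (Fin ρ.dim) (Fin ρ.dim) ℂ) i j

lemma orient_slot (ρ : URep G) (b b' : Bool) (s : SignType) (hs : s = 1 ∨ s = -1) (g : G)
    (i j : Fin ρ.dim) :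
    (ρ.orient b).slot ((bif b then -1 else 1) * (bif b' then -1 else 1) * s) g i j =
      bif b' then star (ρ.slot s g i j) else ρ.slot s g i j := by
  have h0 : ∀ s', (ρ.orient false).slot s' g i j = ρ.slot s' g i j := fun s' => rfl
  have h1 : ∀ s', (ρ.orient true).slot s' g i j =
      if s' = 1 then star (star ((ρ.hom g : Matrix (Fin ρ.dim) (Fin ρ.dim) ℂ) i j))
      else star ((ρ.hom g : Matrix (Fin ρ.dim) (Fin ρ.dim) ℂ) i j) := fun s' => rfl
  have h2 : ((-1 : SignType) = 1) = False := by simp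
  cases b
  · refine (h0 _).trans ?_
    cases b' <;> rcases hs with rfl | rfl <;> simp [slot, h2]
  · refine (h1 _).trans ?_
    cases b' <;> rcases hs with rfl | rfl <;> simp [slot, h2]

end URep

open scoped Classical in
/-- An intertwiner `ι : ⨂_{s f = 1} ρ f → ⨂_{s f = -1} ρ f`.  `coef i` is the matrix entry of `ι`
whose column index consists of the `i f` with `s f = 1` and whose row index consists of the
`i f` with `s f = -1`, and `invariant` is the identity `ρ_out(g) ∘ ι ∘ ρ_in(g)⁻¹ = ι`. -/
structure Intertwiner {F : Type} [Fintype F] (s : F → SignType) (ρ : F → URep G) where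
  coef : (∀ f, Fin (ρ f).dim) → ℂ
  invariant : ∀ (g : G) (i : ∀ f, Fin (ρ f).dim),
    ∑ j : ∀ f, Fin (ρ f).dim, (∏ f, (ρ f).slot (s f) g (i f) (j f)) * coef j = coef i

variable (G) in
/-- The labels that an edge sees: the adjacent faces with their signs and representations, and the
intertwiner. -/
structure EdgeLabel where
  F : Type
  [fintype : Fintype F]
  s : F → SignType
  ρ : F → URep G
  ι : Intertwiner s ρ

attribute [instance] EdgeLabel.fintype

/-- The bijection `φ` of the adjacent faces identifies all labels. -/
structure EdgeLabel.IsIso (L L' : EdgeLabel G) (φ : L.F ≃ L'.F) : Prop where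
  s : ∀ f, L'.s (φ f) = L.s f
  ρ : ∀ f, L'.ρ (φ f) = L.ρ f
  ι : ∀ (i : ∀ f, Fin (L.ρ f).dim) (i' : ∀ f, Fin (L'.ρ f).dim),
    (∀ f, (i' (φ f) : ℕ) = i f) → L'.ι.coef i' = L.ι.coef i

variable (G) in
/-- The labels that a vertex sees: the adjacent edges, with their direction (`true` if the edge
starts at the vertex) and labels, the adjacent faces with their representations, and the incidence
of these faces and edges. -/
structure VertexLabel where
  E : Type
  F : Type
  dir : E → Bool
  label : E → EdgeLabel G
  ρ : F → URep G
  face : ∀ e, (label e).F → F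

/-- Two vertices see the same labels, up to naming of the adjacent edges and faces. -/
def VertexLabel.Iso (L L' : VertexLabel G) : Prop :=
  ∃ (α : L.E ≃ L'.E) (β : L.F ≃ L'.F) (φ : ∀ e, (L.label e).F ≃ (L'.label (α e)).F),
    (∀ e, L'.dir (α e) = L.dir e) ∧ (∀ f, L'.ρ (β f) = L.ρ f) ∧
    (∀ e, (L.label e).IsIso (L'.label (α e)) (φ e)) ∧
    ∀ e f, L'.face (α e) (φ e f) = β (L.face e f)

end Labels

/-! ### Topspin networks and topspin foams -/

section Networks

variable {G : Type*} [Group G] [TopologicalSpace G]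

variable (G) in
/-- A topspin network `(Γ, ρ, ι, σ)` over `G` with topological labels in `S_n`. -/
structure TopspinNetwork (n : ℕ) where
  graph : EmbeddedGraph
  ρ : graph.E → URep G
  ι : ∀ v : graph.V, Intertwiner (graph.sgn v) (fun e : graph.Star v => ρ e.1)
  σ : FundamentalGroup graph.Compl graph.base →* Equiv.Perm (Fin n)

/-- The label of the edge `v × [0, 1]` of the product foam on `Γ × [0, 1]` whose faces
`e × [0, 1]` and edges `v × [0, 1]` are oriented by `o`: reversing a face dualizes its
representation, reversing the edge replaces the intertwiner by its adjoint. -/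
def TopspinNetwork.collarLabel {n : ℕ} (ψ : TopspinNetwork G n) (o : ψ.graph.CollarOrientation)
    (v : ψ.graph.V) : EdgeLabel G where
  F := ψ.graph.Star v
  s e := (bif o.edge e.1 then -1 else 1) * (bif o.vert v then -1 else 1) * ψ.graph.sgn v e
  ρ e := (ψ.ρ e.1).orient (o.edge e.1)
  ι :=
    { coef := fun i => bif o.vert v then star ((ψ.ι v).coef i) else (ψ.ι v).coef i
      invariant := by
        intro g i
        have h := (ψ.ι v).invariant g i
        have hs : ∀ e : ψ.graph.Star v, ψ.graph.sgn v e = 1 ∨ ψ.graph.sgn v e = -1 := by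
          intro e
          unfold EmbeddedGraph.sgn
          split_ifs <;> simp
        have key : ∀ (e : ψ.graph.Star v) (a b : Fin (ψ.ρ e.1).dim),
            ((ψ.ρ e.1).orient (o.edge e.1)).slot ((bif o.edge e.1 then -1 else 1) *
              (bif o.vert v then -1 else 1) * ψ.graph.sgn v e) g a b =
            bif o.vert v then star ((ψ.ρ e.1).slot (ψ.graph.sgn v e) g a b)
              else (ψ.ρ e.1).slot (ψ.graph.sgn v e) g a b := by
          intro e a b
          exact URep.orient_slot _ _ _ _ (hs e) g a b
        refine Eq.trans (Finset.sum_congr rfl fun j _ => congrArg₂ (· * ·)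
          (Finset.prod_congr rfl fun e _ => key e (i e) (j e)) rfl) ?_
        cases h2 : o.vert v
        · exact h
        · have h3 := congrArg star h
          simp only [cond_true]
          rw [← h3, star_sum]
          exact Finset.sum_congr rfl fun j _ => by rw [star_mul', star_prod] }

/-- Labels of the faces of a two-complex by representations, and of its edges that do not lie in
the boundary by intertwiners `⨂_{e ∈ ∂ f} ρ_f → ⨂_{ē ∈ ∂ f} ρ_f`. -/
structure FoamLabels (G : Type*) [Group G] [TopologicalSpace G] {Γ₀ Γ₁ : EmbeddedGraph}
    (C : TwoComplex Γ₀ Γ₁) where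
  ρ : C.F → URep G
  ι : ∀ e : C.IntEdge,
    Intertwiner (fun f : C.Star e.1 => C.inc f.1 e.1) (fun f : C.Star e.1 => ρ f.1)

namespace FoamLabels

variable {Γ₀ Γ₁ : EmbeddedGraph} {C : TwoComplex Γ₀ Γ₁} (L : FoamLabels G C)

/-- The labels at an edge. -/
def edgeLabel (e : C.IntEdge) : EdgeLabel G where
  F := C.Star e.1
  s f := C.inc f.1 e.1
  ρ f := L.ρ f.1
  ι := L.ι e

open scoped Classical in
/-- The labels at a vertex. -/
def vertexLabel (v : C.IntVert) : VertexLabel G where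
  E := {e : C.IntEdge // C.src e.1 = v.1 ∨ C.tgt e.1 = v.1}
  F := {f : C.F // ∃ e : C.IntEdge, (C.src e.1 = v.1 ∨ C.tgt e.1 = v.1) ∧ C.inc f e.1 ≠ 0}
  dir e := decide (C.src e.1.1 = v.1)
  label e := L.edgeLabel e.1
  ρ f := L.ρ f.1
  face e f := ⟨f.1, e.1, e.2, f.2⟩

end FoamLabels

/-- The class of a loop in the fundamental group. -/
abbrev loopClass {X : Type*} [TopologicalSpace X] {x : X} (γ : Path x x) : FundamentalGroup X x :=
  FundamentalGroup.fromPath (Path.Homotopic.Quotient.mk γ)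

/-- A topspin foam `Ψ = (Σ, ρ̃, ι̃, σ̃) : ψ₀ → ψ₁`.

Along the boundary the labels of `f_e` and `e_v` are those of the product foams on `Γ₀ × [0, 1]` and
`Γ₁ × [0, 1]`: `ρ_e` or its dual on `f_e`, and `ι_v`, dualized appropriately, on `e_v`.  The monodromy
`σ̃` restricts to the monodromies of `ψ₀` and `ψ₁`, i.e. the branched covering that it determines
is a cobordism between the branched coverings of `S³` determined by `ψ₀` and `ψ₁`; at the top the
base point `(∞, 1)` is joined to `(∞, 0)` by the vertical segment. -/
structure TopspinFoam {n : ℕ} (ψ₀ ψ₁ : TopspinNetwork G n) where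
  cx : TwoComplex ψ₀.graph ψ₁.graph
  labels : FoamLabels G cx
  σ : FundamentalGroup cx.Compl (cx.basePt 0) →* Equiv.Perm (Fin n)
  face_bot : ∀ e, labels.ρ (cx.srcFace e) = (ψ₀.ρ e).orient (cx.srcOrientation.edge e)
  face_top : ∀ e, labels.ρ (cx.tgtFace e) = (ψ₁.ρ e).orient (cx.tgtOrientation.edge e)
  edge_bot : ∀ v, ∃ φ : ψ₀.graph.Star v ≃ cx.Star (cx.srcEdge v),
    (∀ e, (φ e).1 = cx.srcFace e.1) ∧
    (ψ₀.collarLabel cx.srcOrientation v).IsIso (labels.edgeLabel ⟨_, cx.srcEdge_int v⟩) φ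
  edge_top : ∀ v, ∃ φ : ψ₁.graph.Star v ≃ cx.Star (cx.tgtEdge v),
    (∀ e, (φ e).1 = cx.tgtFace e.1) ∧
    (ψ₁.collarLabel cx.tgtOrientation v).IsIso (labels.edgeLabel ⟨_, cx.tgtEdge_int v⟩) φ
  σ_bot : ∀ (γ : Path ψ₀.graph.base ψ₀.graph.base) (δ : Path (cx.basePt 0) (cx.basePt 0)),
    (∀ t, (δ t : Amb) = (↑(γ t), 0)) → σ (loopClass δ) = ψ₀.σ (loopClass γ)
  σ_top : ∀ (γ : Path ψ₁.graph.base ψ₁.graph.base) (δ : Path (cx.basePt 1) (cx.basePt 1)),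
    (∀ t, (δ t : Amb) = (↑(γ t), 1)) →
      σ (loopClass (((cx.vertical 1).trans δ).trans (cx.vertical 1).symm)) = ψ₁.σ (loopClass γ)

namespace TopspinFoam

variable {n : ℕ} {ψ₀ ψ₁ ψ₂ : TopspinNetwork G n}

/-- Two topspin foams with the same boundary are equivalent if a PL homeomorphism of `S³ × [0, 1]`
relative to the boundary carries one to the other, with all labels. -/
def Equivalent (Ψ Ψ' : TopspinFoam ψ₀ ψ₁) : Prop :=
  ∃ h : Amb → Amb, TwoComplex.IsIsoVia h Ψ.cx Ψ'.cx ∧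
    (∀ (f : Ψ.cx.F) (f' : Ψ'.cx.F), (f' : Set Amb) = h '' f → Ψ'.labels.ρ f' = Ψ.labels.ρ f) ∧
    (∀ (e : Ψ.cx.IntEdge) (e' : Ψ'.cx.IntEdge), (e'.1 : Set Amb) = h '' e.1 →
      ∃ φ : Ψ.cx.Star e.1 ≃ Ψ'.cx.Star e'.1, (∀ f, ((φ f).1 : Set Amb) = h '' f.1) ∧
        (Ψ.labels.edgeLabel e).IsIso (Ψ'.labels.edgeLabel e') φ) ∧
    ∀ (γ : Path (Ψ.cx.basePt 0) (Ψ.cx.basePt 0)) (δ : Path (Ψ'.cx.basePt 0) (Ψ'.cx.basePt 0)),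
      (∀ t, (δ t : Amb) = h (γ t)) → Ψ'.σ (loopClass δ) = Ψ.σ (loopClass γ)

/-- `Ψ = Ψ₁ ∪_ψ Ψ₂` is obtained by gluing `Ψ₁ : ψ₀ → ψ` and `Ψ₂ : ψ → ψ₂` along their common
boundary topspin network: its two-complex is the glued one, and its labels and monodromy restrict
to those of `Ψ₁` and `Ψ₂`. -/
structure IsGluing (Ψ₁ : TopspinFoam ψ₀ ψ₁) (Ψ₂ : TopspinFoam ψ₁ ψ₂) (Ψ : TopspinFoam ψ₀ ψ₂) :
    Prop where
  cx : TwoComplex.IsGluing Ψ₁.cx Ψ₂.cx Ψ.cx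
  ρ₁ : ∀ (f : Ψ₁.cx.F) (g : Ψ.cx.F), lower '' f ⊆ g → Ψ.labels.ρ g = Ψ₁.labels.ρ f
  ρ₂ : ∀ (f : Ψ₂.cx.F) (g : Ψ.cx.F), upper '' f ⊆ g → Ψ.labels.ρ g = Ψ₂.labels.ρ f
  ι₁ : ∀ (e : Ψ₁.cx.IntEdge) (c : Ψ.cx.IntEdge), lower '' e.1 ⊆ c.1 →
    ∃ φ : Ψ₁.cx.Star e.1 ≃ Ψ.cx.Star c.1, (∀ f, lower '' f.1 ⊆ (φ f).1) ∧
      (Ψ₁.labels.edgeLabel e).IsIso (Ψ.labels.edgeLabel c) φ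
  ι₂ : ∀ (e : Ψ₂.cx.IntEdge) (c : Ψ.cx.IntEdge), upper '' e.1 ⊆ c.1 →
    ∃ φ : Ψ₂.cx.Star e.1 ≃ Ψ.cx.Star c.1, (∀ f, upper '' f.1 ⊆ (φ f).1) ∧
      (Ψ₂.labels.edgeLabel e).IsIso (Ψ.labels.edgeLabel c) φ
  σ₁ : ∀ (γ : Path (Ψ₁.cx.basePt 0) (Ψ₁.cx.basePt 0)) (δ : Path (Ψ.cx.basePt 0) (Ψ.cx.basePt 0)),
    (∀ t, (δ t : Amb) = lower (γ t)) → Ψ.σ (loopClass δ) = Ψ₁.σ (loopClass γ)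
  σ₂ : ∀ (γ : Path (Ψ₂.cx.basePt 0) (Ψ₂.cx.basePt 0)) (τ : unitInterval) (_ : (τ : ℝ) = 1 / 2)
    (δ : Path (Ψ.cx.basePt τ) (Ψ.cx.basePt τ)), (∀ t, (δ t : Amb) = upper (γ t)) →
      Ψ.σ (loopClass (((Ψ.cx.vertical τ).trans δ).trans (Ψ.cx.vertical τ).symm)) =
        Ψ₂.σ (loopClass γ)

end TopspinFoam

/-! ### The semigroupoid of topspin networks and foams and its convolution product -/

variable (G) in
/-- The arrows of the semigroupoid `S`: the topspin foams between topspin networks over `G` (with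
topological labels in any `S_n`), up to equivalence. -/
def Arrow : Type _ :=
  Σ (n : ℕ) (ψ₀ ψ₁ : TopspinNetwork G n), Quot (TopspinFoam.Equivalent (ψ₀ := ψ₀) (ψ₁ := ψ₁))

/-- The arrow represented by a topspin foam. -/
def TopspinFoam.arrow {n : ℕ} {ψ₀ ψ₁ : TopspinNetwork G n} (Ψ : TopspinFoam ψ₀ ψ₁) : Arrow G :=
  ⟨n, ψ₀, ψ₁, Quot.mk _ Ψ⟩

/-- `IsComposite a b c` says that `c = a b`: the arrow `c` is the composition of `a` and `b`, by
gluing topspin foams along a common boundary topspin network. -/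
inductive IsComposite : Arrow G → Arrow G → Arrow G → Prop
  | mk {n : ℕ} {ψ₀ ψ₁ ψ₂ : TopspinNetwork G n} (Ψ₁ : TopspinFoam ψ₀ ψ₁) (Ψ₂ : TopspinFoam ψ₁ ψ₂)
      (Ψ : TopspinFoam ψ₀ ψ₂) (h : TopspinFoam.IsGluing Ψ₁ Ψ₂ Ψ) :
      IsComposite Ψ₁.arrow Ψ₂.arrow Ψ.arrow

open scoped Classical in
/-- The convolution product `(f₁ ⋆ f₂)(c) = ∑_{c = a b} f₁(a) f₂(b)`, a finite sum for functions of
finite support. -/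
def conv (f₁ f₂ : Arrow G → ℂ) (c : Arrow G) : ℂ :=
  ∑ᶠ p : Arrow G × Arrow G, if IsComposite p.1 p.2 c then f₁ p.1 * f₂ p.2 else 0

/-- `σ` is a time evolution on the semigroupoid algebra `ℂ[S]` of functions of finite support on
`S` with the convolution product: a one-parameter group of linear maps that preserve `ℂ[S]` and are
multiplicative on it (hence automorphisms of it), pointwise continuous in the time. -/
structure IsTimeEvolution (σ : ℝ → (Arrow G → ℂ) →ₗ[ℂ] (Arrow G → ℂ)) : Prop where
  finite_support : ∀ t f, f.support.Finite → (σ t f).support.Finite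
  zero : σ 0 = LinearMap.id
  add : ∀ s t, σ (s + t) = (σ s).comp (σ t)
  mul : ∀ t f₁ f₂, f₁.support.Finite → f₂.support.Finite →
    σ t (conv f₁ f₂) = conv (σ t f₁) (σ t f₂)
  continuous : ∀ f c, Continuous fun t => σ t f c

end Networks

/-! ### Spin foam models and amplitudes -/

section Models

/-- A spin foam model over `G`: amplitudes of faces, edges and vertices that depend only on the
labels that these cells see, and a weight factor `ω(Σ)` that depends only on the embedded
two-complex `Σ`, up to PL homeomorphisms of `S³ × [0, 1]` relative to the boundary. -/
structure SpinFoamModel (G : Type*) [Group G] [TopologicalSpace G] where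
  faceAmp : URep G → ℂ
  edgeAmp : EdgeLabel G → ℂ
  edgeAmp_iso : ∀ L L' φ, EdgeLabel.IsIso L L' φ → edgeAmp L = edgeAmp L'
  vertexAmp : VertexLabel G → ℂ
  vertexAmp_iso : ∀ L L', VertexLabel.Iso L L' → vertexAmp L = vertexAmp L'
  weight : ∀ {Γ₀ Γ₁ : EmbeddedGraph}, TwoComplex Γ₀ Γ₁ → ℂ
  weight_iso : ∀ {Γ₀ Γ₁ : EmbeddedGraph} (C C' : TwoComplex Γ₀ Γ₁) (h : Amb → Amb),
    TwoComplex.IsIsoVia h C C' → weight C = weight C'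

namespace SpinFoamModel

variable {G : Type*} [Group G] [TopologicalSpace G] (M : SpinFoamModel G)

/-- `ω(Σ₁ ∪_Γ Σ₂) = ω(Σ₁) ω(Σ₂)`. -/
def WeightMultiplicative : Prop :=
  ∀ {Γ₀ Γ₁ Γ₂ : EmbeddedGraph} (C₁ : TwoComplex Γ₀ Γ₁) (C₂ : TwoComplex Γ₁ Γ₂)
    (C : TwoComplex Γ₀ Γ₂), TwoComplex.IsGluing C₁ C₂ C →
      M.weight C = M.weight C₁ * M.weight C₂

open scoped Classical in
/-- The amplitude `A(Ψ) = ω(Σ) ∏_f A_f ∏_e A_e ∏_v A_v`, over all faces of `Σ` and over the edges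
and vertices that do not lie in the boundary graphs (those that have labels in `Ψ`). -/
def amplitude {n : ℕ} {ψ₀ ψ₁ : TopspinNetwork G n} (Ψ : TopspinFoam ψ₀ ψ₁) : ℂ :=
  M.weight Ψ.cx * (∏ f : Ψ.cx.F, M.faceAmp (Ψ.labels.ρ f)) *
    (∏ e : Ψ.cx.IntEdge, M.edgeAmp (Ψ.labels.edgeLabel e)) *
    ∏ v : Ψ.cx.IntVert, M.vertexAmp (Ψ.labels.vertexLabel v)

/-- The amplitude `A(ψ) = ∏_e A_{f_e} ∏_v A_{e_v}` of a network, with the amplitudes of the cells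
`f_e = e × [0, 1]` and `e_v = v × [0, 1]`, oriented by `o`, of the product foam on `Γ × [0, 1]`. -/
def networkAmplitude {n : ℕ} (ψ : TopspinNetwork G n) (o : ψ.graph.CollarOrientation) : ℂ :=
  (∏ e : ψ.graph.E, M.faceAmp ((ψ.ρ e).orient (o.edge e))) *
    ∏ v : ψ.graph.V, M.edgeAmp (ψ.collarLabel o v)

/-- The amplitude `A(ψ₀)` of the source of `Ψ : ψ₀ → ψ₁`; the product foam on `Γ₀ × [0, 1]` is
oriented as `Σ` is near `Γ₀`. -/
def sourceAmplitude {n : ℕ} {ψ₀ ψ₁ : TopspinNetwork G n} (Ψ : TopspinFoam ψ₀ ψ₁) : ℂ :=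
  M.networkAmplitude ψ₀ Ψ.cx.srcOrientation

/-- The normalized amplitude `A⁰(Ψ) = A(Ψ) / A(ψ₀)`. -/
def normAmplitude {n : ℕ} {ψ₀ ψ₁ : TopspinNetwork G n} (Ψ : TopspinFoam ψ₀ ψ₁) : ℂ :=
  M.amplitude Ψ / M.sourceAmplitude Ψ

/-- The amplitudes of all topspin foams and of their source networks are positive real numbers. -/
def HasPositiveAmplitudes : Prop :=
  ∀ {n : ℕ} {ψ₀ ψ₁ : TopspinNetwork G n} (Ψ : TopspinFoam ψ₀ ψ₁),
    (∃ r : ℝ, 0 < r ∧ M.amplitude Ψ = r) ∧ ∃ r : ℝ, 0 < r ∧ M.sourceAmplitude Ψ = r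

end SpinFoamModel

end Models

end SpinFoam

end

noncomputable section

namespace SpinFoam

/-! ### Combinatorics of glued families of cells -/

/-! Gluing along `Γ` is a pushout of cells. The faces of `Σ` are those of `Σ₁` and `Σ₂`, with the
two copies of `f_e` identified for each edge `e` of `Γ`; the edges outside the boundary graphs
behave in the same way, with `e_v` in place of `f_e`; the vertices outside the boundary graphs form
a disjoint union, since those of `Γ` disappear inside the glued edges. In `A(Ψ₁) A(Ψ₂)` the glued
cells are therefore counted twice, while in `A(Ψ)` they occur once. The surplus consists of the
amplitudes of the cells of `Ψ₂` along `Γ`, and by the boundary conditions on labels it is the source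
amplitude of `Ψ₂`. Hence `A(Ψ) A(ψ) = A(Ψ₁) A(Ψ₂)`, where `A(ψ)` is taken with the orientation of
`Ψ₂`. As `Ψ` and `Ψ₁` have the same collar at the bottom, they have the same source amplitude, and
division gives the first claim.

The combinatorics is done once, for abstract families of sets (`CellGluing`): containment of a part
in a glued cell is the graph of an injection from either side, and `prod_pushout` is
inclusion-exclusion for products over the two images. The geometric input is that distinct cells of
one dimension never contain each other and that the halves of the cylinder meet only at height
`1/2`. Vertex amplitudes also need that a vertex off `Γ` sees the same labels before and after
gluing (`FoamLabels.vertexLabel_iso_of_cellGluing`).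

For the time evolution, a PL homeomorphism relative to the boundary matches all cells and labels, so
`A⁰` descends to arrows. There it is positive and multiplicative under composition, and `(xy)^z =
x^z y^z` for positive reals makes `σ_t` multiplicative term by term in the convolution sum. -/

/-- The family `A` of sets is obtained from the families `A₁` and `A₂` by gluing the members `t i`
of `A₁`, along their parts in `B₁`, to the members `s i` of `A₂`, along their parts in `B₂`. -/
structure CellGluing {X : Type*} {I : Type*} (j₁ j₂ : X → X) (B₁ B₂ : Set X)
    (A₁ A₂ A : Set (Set X)) (t s : I → Set X) : Prop where
  inj₁ : Function.Injective j₁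
  inj₂ : Function.Injective j₂
  antichain₁ : ∀ f ∈ A₁, ∀ f' ∈ A₁, f ⊆ f' → f = f'
  antichain₂ : ∀ f ∈ A₂, ∀ f' ∈ A₂, f ⊆ f' → f = f'
  nonempty₁ : ∀ f ∈ A₁, f.Nonempty
  nonempty₂ : ∀ f ∈ A₂, f.Nonempty
  meet₁ : ∀ f ∈ A₁, (f ∩ B₁).Nonempty → ∃ i, f = t i
  meet₂ : ∀ f ∈ A₂, (f ∩ B₂).Nonempty → ∃ i, f = s i
  t_mem : ∀ i, t i ∈ A₁
  s_mem : ∀ i, s i ∈ A₂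
  t_meet : ∀ i, (t i ∩ B₁).Nonempty
  s_meet : ∀ i, (s i ∩ B₂).Nonempty
  t_inj : Function.Injective t
  s_inj : Function.Injective s
  glue : ∀ i, j₁ '' (t i ∩ B₁) = j₂ '' (s i ∩ B₂)
  overlap : ∀ f ∈ A₁, ∀ g ∈ A₂, ∀ p ∈ f, ∀ q ∈ g, j₁ p = j₂ q → p ∈ B₁ ∧ q ∈ B₂
  mem_iff : ∀ a, a ∈ A ↔ (∃ f ∈ A₁, f ∩ B₁ = ∅ ∧ a = j₁ '' f) ∨
    (∃ f ∈ A₂, f ∩ B₂ = ∅ ∧ a = j₂ '' f) ∨ ∃ i, a = j₁ '' t i ∪ j₂ '' s i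

namespace CellGluing

variable {X : Type*} {I : Type*} {j₁ j₂ : X → X} {B₁ B₂ : Set X}
  {A₁ A₂ A : Set (Set X)} {t s : I → Set X}

lemma symm (h : CellGluing j₁ j₂ B₁ B₂ A₁ A₂ A t s) : CellGluing j₂ j₁ B₂ B₁ A₂ A₁ A s t where
  inj₁ := h.inj₂
  inj₂ := h.inj₁
  antichain₁ := h.antichain₂
  antichain₂ := h.antichain₁
  nonempty₁ := h.nonempty₂
  nonempty₂ := h.nonempty₁
  meet₁ := h.meet₂
  meet₂ := h.meet₁
  t_mem := h.s_mem
  s_mem := h.t_mem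
  t_meet := h.s_meet
  s_meet := h.t_meet
  t_inj := h.s_inj
  s_inj := h.t_inj
  glue i := (h.glue i).symm
  overlap f hf g hg p hp q hq e := (h.overlap g hg f hf q hq p hp e.symm).symm
  mem_iff a := by
    rw [h.mem_iff a, or_left_comm]
    simp only [Set.union_comm]

lemma exists_superset (h : CellGluing j₁ j₂ B₁ B₂ A₁ A₂ A t s) {f : Set X} (hf : f ∈ A₁) :
    ∃ a ∈ A, j₁ '' f ⊆ a := by
  by_cases hm : (f ∩ B₁).Nonempty
  · obtain ⟨i, rfl⟩ := h.meet₁ f hf hm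
    exact ⟨_, (h.mem_iff _).2 (.inr (.inr ⟨i, rfl⟩)), Set.subset_union_left⟩
  · exact ⟨_, (h.mem_iff _).2 (.inl ⟨f, hf, Set.not_nonempty_iff_eq_empty.1 hm, rfl⟩), subset_rfl⟩

/-- A point of `j₁ '' f` that falls into the second part lies in the overlap, and by `glue` the
overlap already belongs to `j₁ '' t i`. So `f ⊆ t i`, and the antichain condition gives equality. -/
lemma eq_of_image_subset_union (h : CellGluing j₁ j₂ B₁ B₂ A₁ A₂ A t s) {f : Set X} (hf : f ∈ A₁)
    {i : I} (hi : j₁ '' f ⊆ j₁ '' t i ∪ j₂ '' s i) : f = t i := by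
  refine h.antichain₁ f hf _ (h.t_mem i) fun p hp => ?_
  rcases hi ⟨p, hp, rfl⟩ with ⟨q, hq, e⟩ | ⟨q, hq, e⟩
  · exact h.inj₁ e ▸ hq
  · have ho := h.overlap f hf _ (h.s_mem i) p hp q hq e.symm
    have : j₂ q ∈ j₁ '' (t i ∩ B₁) := by rw [h.glue]; exact ⟨q, ⟨hq, ho.2⟩, rfl⟩
    obtain ⟨r, hr, e'⟩ := this
    exact h.inj₁ (e'.trans e) ▸ hr.1

/-- A cell taken over unchanged from the second side misses `B₂`, whereas any point shared with `j₁
'' f` would lie in `B₂`; only the other two kinds of members of `A` can contain `j₁ '' f`. -/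
lemma eq_of_image_subset (h : CellGluing j₁ j₂ B₁ B₂ A₁ A₂ A t s) {f a : Set X} (hf : f ∈ A₁)
    (ha : a ∈ A) (hfa : j₁ '' f ⊆ a) :
    (f ∩ B₁ = ∅ ∧ a = j₁ '' f) ∨ ∃ i, f = t i ∧ a = j₁ '' t i ∪ j₂ '' s i := by
  rcases (h.mem_iff a).1 ha with ⟨f', hf', h0, rfl⟩ | ⟨f', hf', h0, rfl⟩ | ⟨i, rfl⟩
  · have := h.antichain₁ f hf f' hf' ((Set.image_subset_image_iff h.inj₁).1 hfa)
    subst this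
    exact .inl ⟨h0, rfl⟩
  · obtain ⟨p, hp⟩ := h.nonempty₁ f hf
    obtain ⟨q, hq, e⟩ := hfa ⟨p, hp, rfl⟩
    exact absurd (h0 ▸ ⟨hq, (h.overlap f hf f' hf' p hp q hq e.symm).2⟩ : q ∈ (∅ : Set X)) id
  · exact .inr ⟨i, h.eq_of_image_subset_union hf hfa, rfl⟩

/-- Together with `exists_superset` and `subset_unique`, this makes `j₁ '' f ⊆ a` the graph of an
injection `A₁ → A`. -/
lemma superset_unique (h : CellGluing j₁ j₂ B₁ B₂ A₁ A₂ A t s) {f a a' : Set X} (hf : f ∈ A₁)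
    (ha : a ∈ A) (ha' : a' ∈ A) (hfa : j₁ '' f ⊆ a) (hfa' : j₁ '' f ⊆ a') : a = a' := by
  rcases h.eq_of_image_subset hf ha hfa with ⟨h0, rfl⟩ | ⟨i, rfl, rfl⟩ <;>
    rcases h.eq_of_image_subset hf ha' hfa' with ⟨h0', rfl⟩ | ⟨i', e, rfl⟩
  · rfl
  · exact absurd h0 (e ▸ (h.t_meet i').ne_empty)
  · exact absurd h0' (h.t_meet i).ne_empty
  · rw [h.t_inj e]

lemma subset_unique (h : CellGluing j₁ j₂ B₁ B₂ A₁ A₂ A t s) {f f' a : Set X} (hf : f ∈ A₁)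
    (hf' : f' ∈ A₁) (ha : a ∈ A) (hfa : j₁ '' f ⊆ a) (hfa' : j₁ '' f' ⊆ a) : f = f' := by
  rcases h.eq_of_image_subset hf ha hfa with ⟨-, rfl⟩ | ⟨i, rfl, rfl⟩
  · exact (h.antichain₁ f' hf' f hf ((Set.image_subset_image_iff h.inj₁).1 hfa')).symm
  · exact (h.eq_of_image_subset_union hf' hfa').symm

lemma exists_subset (h : CellGluing j₁ j₂ B₁ B₂ A₁ A₂ A t s) {a : Set X} (ha : a ∈ A) :
    (∃ f ∈ A₁, j₁ '' f ⊆ a) ∨ ∃ f ∈ A₂, j₂ '' f ⊆ a := by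
  rcases (h.mem_iff a).1 ha with ⟨f, hf, -, rfl⟩ | ⟨f, hf, -, rfl⟩ | ⟨i, rfl⟩
  · exact .inl ⟨f, hf, subset_rfl⟩
  · exact .inr ⟨f, hf, subset_rfl⟩
  · exact .inl ⟨_, h.t_mem i, Set.subset_union_left⟩

/-- The injections from the two sides have only the glued cells as common values: this is the
intersection term of the inclusion-exclusion. -/
lemma eq_of_image_subset_both (h : CellGluing j₁ j₂ B₁ B₂ A₁ A₂ A t s) {f g a : Set X}
    (hf : f ∈ A₁) (hg : g ∈ A₂) (ha : a ∈ A) (hfa : j₁ '' f ⊆ a) (hga : j₂ '' g ⊆ a) :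
    ∃ i, f = t i ∧ g = s i := by
  rcases h.eq_of_image_subset hf ha hfa with ⟨h0, rfl⟩ | ⟨i, rfl, rfl⟩
  · obtain ⟨q, hq⟩ := h.nonempty₂ g hg
    obtain ⟨p, hp, e⟩ := hga ⟨q, hq, rfl⟩
    exact absurd (h0 ▸ ⟨hp, (h.overlap f hf g hg p hp q hq e).1⟩ : p ∈ (∅ : Set X)) id
  · exact ⟨i, rfl, h.symm.eq_of_image_subset_union hg (by rwa [Set.union_comm])⟩

end CellGluing

open scoped Classical in
/-- The product over a pushout of finite types, presented by relations. -/
lemma prod_pushout {X X₁ X₂ I R : Type*} [Fintype X] [Fintype X₁] [Fintype X₂] [Fintype I]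
    [CommMonoid R] (R₁ : X₁ → X → Prop) (R₂ : X₂ → X → Prop) (t : I → X₁) (s : I → X₂)
    (a : X → R) (a₁ : X₁ → R) (a₂ : X₂ → R)
    (ex₁ : ∀ x, ∃ y, R₁ x y) (ex₂ : ∀ x, ∃ y, R₂ x y)
    (inj₁ : ∀ x x' y, R₁ x y → R₁ x' y → x = x') (inj₂ : ∀ x x' y, R₂ x y → R₂ x' y → x = x')
    (uniq₁ : ∀ x y y', R₁ x y → R₁ x y' → y = y') (uniq₂ : ∀ x y y', R₂ x y → R₂ x y' → y = y')
    (cover : ∀ y, (∃ x, R₁ x y) ∨ ∃ x, R₂ x y)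
    (both : ∀ x x' y, R₁ x y → R₂ x' y → ∃ i, x = t i ∧ x' = s i)
    (glue : ∀ i, ∃ y, R₁ (t i) y ∧ R₂ (s i) y)
    (s_inj : Function.Injective s)
    (ha₁ : ∀ x y, R₁ x y → a y = a₁ x) (ha₂ : ∀ x y, R₂ x y → a y = a₂ x) :
    (∏ y, a y) * ∏ i, a₂ (s i) = (∏ x, a₁ x) * ∏ x, a₂ x := by
  choose k₁ hk₁ using ex₁
  choose k₂ hk₂ using ex₂
  have i₁ : Function.Injective k₁ := fun x x' e => inj₁ x x' _ (hk₁ x) (e ▸ hk₁ x')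
  have i₂ : Function.Injective k₂ := fun x x' e => inj₂ x x' _ (hk₂ x) (e ▸ hk₂ x')
  have hu : Finset.univ.image k₁ ∪ Finset.univ.image k₂ = Finset.univ := by
    ext y
    simp only [Finset.mem_union, Finset.mem_image, Finset.mem_univ, true_and, iff_true]
    exact (cover y).imp (fun ⟨x, hx⟩ => ⟨x, uniq₁ x _ _ (hk₁ x) hx⟩)
      fun ⟨x, hx⟩ => ⟨x, uniq₂ x _ _ (hk₂ x) hx⟩
  have hi : Finset.univ.image k₁ ∩ Finset.univ.image k₂ = Finset.univ.image (k₂ ∘ s) := by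
    ext y
    simp only [Finset.mem_inter, Finset.mem_image, Finset.mem_univ, true_and, Function.comp]
    constructor
    · rintro ⟨⟨x, rfl⟩, x', e⟩
      obtain ⟨i, rfl, rfl⟩ := both x x' _ (hk₁ x) (e ▸ hk₂ x')
      exact ⟨i, e⟩
    · rintro ⟨i, rfl⟩
      obtain ⟨y, h1, h2⟩ := glue i
      exact ⟨⟨t i, (uniq₁ _ _ _ (hk₁ _) h1).trans (uniq₂ _ _ _ (hk₂ _) h2).symm⟩, s i, rfl⟩
  -- Inclusion-exclusion in multiplicative form, without division: the images of `k₁` and `k₂` cover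
  -- `X` and intersect in the image of `I`.
  have := Finset.prod_union_inter (s₁ := Finset.univ.image k₁) (s₂ := Finset.univ.image k₂) (f := a)
  rw [hu, hi, Finset.prod_image i₁.injOn, Finset.prod_image i₂.injOn,
    Finset.prod_image (i₂.comp s_inj).injOn] at this
  simpa only [Function.comp, ha₁ _ _ (hk₁ _), ha₂ _ _ (hk₂ _)] using this

/-! ### Isomorphisms of vertex labels -/

section Labels

variable {G : Type*} [Group G] [TopologicalSpace G]

/-- Vertices of two labelled two-complexes see the same labels if correspondences `RE` and `RF` of
the edges and faces match the cells at these vertices, with their labels. -/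
lemma FoamLabels.vertexLabel_iso {Γ₀ Γ₁ Γ₀' Γ₁' : EmbeddedGraph} {C : TwoComplex Γ₀ Γ₁}
    {C' : TwoComplex Γ₀' Γ₁'} (L : FoamLabels G C) (L' : FoamLabels G C')
    (v : C.IntVert) (v' : C'.IntVert) (RE : C.IntEdge → C'.IntEdge → Prop)
    (RF : C.F → C'.F → Prop)
    (src_iff : ∀ e e', RE e e' → (C.src e.1 = v.1 ↔ C'.src e'.1 = v'.1))
    (tgt_iff : ∀ e e', RE e e' → (C.tgt e.1 = v.1 ↔ C'.tgt e'.1 = v'.1))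
    (exE : ∀ e : C.IntEdge, ∃ e', RE e e')
    (exE' : ∀ e' : C'.IntEdge, C'.src e'.1 = v'.1 ∨ C'.tgt e'.1 = v'.1 → ∃ e, RE e e')
    (uniqE : ∀ e e₁ e₂, RE e e₁ → RE e e₂ → e₁ = e₂)
    (injE : ∀ e₁ e₂ e', RE e₁ e' → RE e₂ e' → e₁ = e₂)
    (uniqF : ∀ f f₁ f₂, RF f f₁ → RF f f₂ → f₁ = f₂)
    (injF : ∀ f₁ f₂ f', RF f₁ f' → RF f₂ f' → f₁ = f₂)
    (hρ : ∀ f f', RF f f' → L'.ρ f' = L.ρ f)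
    (hι : ∀ e e', RE e e' → ∃ φ : C.Star e.1 ≃ C'.Star e'.1, (∀ f, RF f.1 (φ f).1) ∧
      (L.edgeLabel e).IsIso (L'.edgeLabel e') φ) :
    (L.vertexLabel v).Iso (L'.vertexLabel v') := by
  choose k hk using exE
  choose φ hφF hφ using hι
  have hat : ∀ e e', RE e e' → (C.src e.1 = v.1 ∨ C.tgt e.1 = v.1) →
      (C'.src e'.1 = v'.1 ∨ C'.tgt e'.1 = v'.1) := fun e e' h =>
    Or.imp (src_iff e e' h).1 (tgt_iff e e' h).1
  have hat' : ∀ e e', RE e e' → (C'.src e'.1 = v'.1 ∨ C'.tgt e'.1 = v'.1) →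
      (C.src e.1 = v.1 ∨ C.tgt e.1 = v.1) := fun e e' h =>
    Or.imp (src_iff e e' h).2 (tgt_iff e e' h).2
  have hα : Function.Bijective (fun e : (L.vertexLabel v).E =>
      (⟨k e.1, hat _ _ (hk _) e.2⟩ : (L'.vertexLabel v').E)) := by
    constructor
    · intro e₁ e₂ h
      have h' : k e₁.1 = k e₂.1 := congrArg Subtype.val h
      exact Subtype.ext (injE _ _ _ (hk e₁.1) (h' ▸ hk e₂.1))
    · rintro ⟨e', he'⟩
      obtain ⟨e, he⟩ := exE' e' he'
      exact ⟨⟨e, hat' _ _ he he'⟩, Subtype.ext (uniqE e _ _ (hk e) he)⟩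
  -- A face at `v` is known only through some edge `e` at `v`, so its partner is found with the
  -- bijection `φ` at that edge. By `uniqF` the result does not depend on `e`, which gives the
  -- compatibility with `face` at the end.
  have exF : ∀ f : (L.vertexLabel v).F, ∃ f' : (L'.vertexLabel v').F, RF f.1 f'.1 := by
    rintro ⟨f, e, he, hf⟩
    exact ⟨⟨(φ e _ (hk e) ⟨f, hf⟩).1, k e, hat _ _ (hk e) he, (φ e _ (hk e) ⟨f, hf⟩).2⟩,
      hφF e _ (hk e) ⟨f, hf⟩⟩
  choose l hl using exF
  have hβ : Function.Bijective l := by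
    constructor
    · intro f₁ f₂ h
      exact Subtype.ext (injF _ _ _ (hl f₁) (h ▸ hl f₂))
    · rintro ⟨f', e', he', hf'⟩
      obtain ⟨e, he⟩ := exE' e' he'
      obtain ⟨f, hf⟩ := (φ e e' he).surjective ⟨f', hf'⟩
      refine ⟨⟨f.1, e, hat' _ _ he he', f.2⟩,
        Subtype.ext (uniqF f.1 _ _ (hl ⟨f.1, e, hat' _ _ he he', f.2⟩) ?_)⟩
      have := hφF e e' he f
      rwa [hf] at this
  refine ⟨Equiv.ofBijective _ hα, Equiv.ofBijective _ hβ, fun e => φ e.1 _ (hk e.1), ?_, ?_, ?_, ?_⟩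
  · intro e
    exact decide_eq_decide.2 (src_iff _ _ (hk e.1)).symm
  · intro f
    exact hρ _ _ (hl f)
  · intro e
    exact hφ e.1 _ (hk e.1)
  · intro e f
    exact Subtype.ext (uniqF f.1 _ _ (hφF e.1 _ (hk e.1) f)
      (hl ((L.vertexLabel v).face e f)))

end Labels

/-! ### Cells of embedded complexes -/

section Cells

variable {E : Type*} [AddCommGroup E] [Module ℝ E] [TopologicalSpace E] {s c : Set E} {a b : E}

lemma IsArc.left_mem (h : IsArc s a b) : a ∈ s := by
  obtain ⟨-, φ, -, -, rfl, rfl, -⟩ := h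
  exact ⟨0, rfl⟩

lemma IsArc.right_mem (h : IsArc s a b) : b ∈ s := by
  obtain ⟨-, φ, -, -, rfl, -, rfl⟩ := h
  exact ⟨1, rfl⟩

lemma IsArc.ne (h : IsArc s a b) : a ≠ b := by
  obtain ⟨-, φ, -, hi, -, rfl, rfl⟩ := h
  exact fun e => zero_ne_one (hi e)

lemma IsArc.infinite (h : IsArc s a b) : s.Infinite := by
  obtain ⟨-, φ, -, hi, rfl, -, -⟩ := h
  have : Infinite unitInterval := (Set.Icc_infinite zero_lt_one).to_subtype
  exact Set.infinite_range_of_injective hi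

/-- The image of the centre is off the boundary circle, because the parametrization is injective. -/
lemma IsDisc.not_subset (h : IsDisc s c) : ¬ s ⊆ c := by
  obtain ⟨-, φ, -, hi, rfl, rfl⟩ := h
  intro hs
  obtain ⟨x, hx, e⟩ := hs ⟨⟨0, by simp⟩, rfl⟩
  have := hi e
  subst this
  simp at hx

lemma IsDisc.nonempty (h : IsDisc s c) : s.Nonempty := by
  by_contra hs
  exact h.not_subset ((Set.not_nonempty_iff_eq_empty.1 hs) ▸ Set.empty_subset _)

end Cells

namespace TwoComplex

variable {Γ₀ Γ₁ : EmbeddedGraph} (C : TwoComplex Γ₀ Γ₁)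

lemma src_mem (e : C.E) : (C.src e : Amb) ∈ (e : Set Amb) := (C.isArc e).left_mem

lemma tgt_mem (e : C.E) : (C.tgt e : Amb) ∈ (e : Set Amb) := (C.isArc e).right_mem

lemma src_ne_tgt (e : C.E) : C.src e ≠ C.tgt e :=
  fun h => (C.isArc e).ne (congrArg Subtype.val h)

/-- Distinct edges share only vertices, of which there are finitely many, while an arc is infinite.
-/
lemma eq_of_edge_subset {e e' : Set Amb} (he : e ∈ C.E) (he' : e' ∈ C.E) (h : e ⊆ e') : e = e' := by
  by_contra hne
  exact (C.isArc ⟨e, he⟩).infinite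
    (C.V.finite_toSet.subset fun p hp => C.edge_edge e he e' he' hne p ⟨hp, h hp⟩)

/-- Distinct faces meet only in boundary points, and a disc is not contained in its boundary circle.
-/
lemma eq_of_face_subset {f f' : Set Amb} (hf : f ∈ C.F) (hf' : f' ∈ C.F) (h : f ⊆ f') : f = f' := by
  by_contra hne
  refine (C.isDisc ⟨f, hf⟩).not_subset fun p hp => ?_
  obtain ⟨e, he, hp'⟩ := C.face_face ⟨f, hf⟩ ⟨f', hf'⟩ (fun h => hne (congrArg Subtype.val h)) p
    ⟨hp, h hp⟩
  exact Set.mem_iUnion₂.2 ⟨e, he, hp'⟩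

/-- The slice of the collar at its extreme height. These slices show that the cells below and above
an edge or vertex of `Γ` meet the gluing level in the same set, and that they determine that edge or
vertex. -/
lemma tgtFace_inter (e : Γ₁.E) :
    (C.tgtFace e : Set Amb) ∩ {p | p.2 = 1} = e.1 ×ˢ {1} := by
  obtain ⟨ε, h0, h1, h, -⟩ := C.collar_top
  ext ⟨x, t⟩
  have := Set.ext_iff.1 (h e) (x, t)
  simp only [Set.mem_inter_iff, Set.mem_ofPred_eq, Set.mem_prod, Set.mem_Ioc,
    Set.mem_singleton_iff] at this ⊢
  constructor
  · rintro ⟨hx, rfl⟩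
    exact ⟨(this.1 ⟨hx, by linarith⟩).1, rfl⟩
  · rintro ⟨hx, rfl⟩
    exact ⟨(this.2 ⟨hx, by linarith, le_rfl⟩).1, rfl⟩

lemma tgtEdge_inter (v : Γ₁.V) :
    (C.tgtEdge v : Set Amb) ∩ {p | p.2 = 1} = {v.1} ×ˢ {1} := by
  obtain ⟨ε, h0, h1, -, h, -⟩ := C.collar_top
  ext ⟨x, t⟩
  have := Set.ext_iff.1 (h v) (x, t)
  simp only [Set.mem_inter_iff, Set.mem_ofPred_eq, Set.mem_prod, Set.mem_Ioc,
    Set.mem_singleton_iff] at this ⊢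
  constructor
  · rintro ⟨hx, rfl⟩
    exact ⟨(this.1 ⟨hx, by linarith⟩).1, rfl⟩
  · rintro ⟨hx, rfl⟩
    exact ⟨(this.2 ⟨hx, by linarith, le_rfl⟩).1, rfl⟩

lemma srcFace_inter (e : Γ₀.E) :
    (C.srcFace e : Set Amb) ∩ {p | p.2 = 0} = e.1 ×ˢ {0} := by
  obtain ⟨ε, h0, h1, h, -⟩ := C.collar_bot
  ext ⟨x, t⟩
  have := Set.ext_iff.1 (h e) (x, t)
  simp only [Set.mem_inter_iff, Set.mem_ofPred_eq, Set.mem_prod, Set.mem_Ico,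
    Set.mem_singleton_iff] at this ⊢
  constructor
  · rintro ⟨hx, rfl⟩
    exact ⟨(this.1 ⟨hx, by linarith⟩).1, rfl⟩
  · rintro ⟨hx, rfl⟩
    exact ⟨(this.2 ⟨hx, le_rfl, by linarith⟩).1, rfl⟩

lemma srcEdge_inter (v : Γ₀.V) :
    (C.srcEdge v : Set Amb) ∩ {p | p.2 = 0} = {v.1} ×ˢ {0} := by
  obtain ⟨ε, h0, h1, -, h, -⟩ := C.collar_bot
  ext ⟨x, t⟩
  have := Set.ext_iff.1 (h v) (x, t)
  simp only [Set.mem_inter_iff, Set.mem_ofPred_eq, Set.mem_prod, Set.mem_Ico,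
    Set.mem_singleton_iff] at this ⊢
  constructor
  · rintro ⟨hx, rfl⟩
    exact ⟨(this.1 ⟨hx, by linarith⟩).1, rfl⟩
  · rintro ⟨hx, rfl⟩
    exact ⟨(this.2 ⟨hx, le_rfl, by linarith⟩).1, rfl⟩

/-- By the collar condition a face other than the `f_e` stays at height at most `1 - ε`. -/
lemma exists_tgtFace (f : C.F) (h : ((f : Set Amb) ∩ {p | p.2 = 1}).Nonempty) :
    ∃ e, f = C.tgtFace e := by
  obtain ⟨ε, h0, h1, -, -, hf, -⟩ := C.collar_top
  obtain ⟨p, hp, hp1⟩ := h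
  refine (hf f).resolve_right fun h => ?_
  have := h p hp
  have hp1 : p.2 = 1 := hp1
  linarith

lemma exists_srcFace (f : C.F) (h : ((f : Set Amb) ∩ {p | p.2 = 0}).Nonempty) :
    ∃ e, f = C.srcFace e := by
  obtain ⟨ε, h0, h1, -, -, hf, -⟩ := C.collar_bot
  obtain ⟨p, hp, hp1⟩ := h
  refine (hf f).resolve_right fun h => ?_
  have := h p hp
  have hp1 : p.2 = 0 := hp1
  linarith

lemma exists_tgtEdge (e : C.E) (h : ((e : Set Amb) ∩ {p | p.2 = 1}).Nonempty)
    (he : ¬ (e : Set Amb) ⊆ {p | p.2 = 1}) : ∃ v, e = C.tgtEdge v := by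
  obtain ⟨ε, h0, h1, -, -, -, hf, -⟩ := C.collar_top
  obtain ⟨p, hp, hp1⟩ := h
  rcases hf e with h | ⟨s, -, h⟩ | h
  · exact h
  · exact absurd (fun p hp => (h ▸ hp : p ∈ s ×ˢ ({1} : Set ℝ)).2) he
  · have := h p hp
    have hp1 : p.2 = 1 := hp1
    linarith

lemma exists_srcEdge (e : C.E) (h : ((e : Set Amb) ∩ {p | p.2 = 0}).Nonempty)
    (he : ¬ (e : Set Amb) ⊆ {p | p.2 = 0}) : ∃ v, e = C.srcEdge v := by
  obtain ⟨ε, h0, h1, -, -, -, hf, -⟩ := C.collar_bot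
  obtain ⟨p, hp, hp1⟩ := h
  rcases hf e with h | ⟨s, -, h⟩ | h
  · exact h
  · exact absurd (fun p hp => (h ▸ hp : p ∈ s ×ˢ ({0} : Set ℝ)).2) he
  · have := h p hp
    have hp1 : p.2 = 0 := hp1
    linarith

/-- The sets that are edges not in the boundary graphs. -/
def intEdges : Set (Set Amb) :=
  {e | e ∈ C.E ∧ ¬ e ⊆ {p | p.2 = 0} ∧ ¬ e ⊆ {p | p.2 = 1}}

lemma IntEdge.mem_intEdges {C : TwoComplex Γ₀ Γ₁} (e : C.IntEdge) : (e.1 : Set Amb) ∈ C.intEdges :=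
  ⟨e.1.2, e.2⟩

lemma intEdge_ext {e e' : C.IntEdge} (h : (e.1 : Set Amb) = e'.1) : e = e' :=
  Subtype.ext (Subtype.ext h)

end TwoComplex

/-! ### The two halves of the cylinder and the gluing of cells -/

lemma lower_injective : Function.Injective lower := by
  rintro ⟨x, t⟩ ⟨y, u⟩ h
  simp only [lower, Prod.mk.injEq] at h
  exact Prod.ext h.1 (by simpa using h.2)

lemma upper_injective : Function.Injective upper := by
  rintro ⟨x, t⟩ ⟨y, u⟩ h
  simp only [upper, Prod.mk.injEq] at h
  exact Prod.ext h.1 (by simpa using h.2)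

lemma lower_image_eq_upper_image (s : Set (Fin 4 → ℝ)) :
    lower '' (s ×ˢ {1}) = upper '' (s ×ˢ {0}) := by
  ext p
  constructor
  · rintro ⟨⟨x, t⟩, ⟨hx, rfl⟩, rfl⟩
    exact ⟨(x, 0), ⟨hx, rfl⟩, by simp [lower, upper]⟩
  · rintro ⟨⟨x, t⟩, ⟨hx, rfl⟩, rfl⟩
    exact ⟨(x, 1), ⟨hx, rfl⟩, by simp [lower, upper]⟩

/-- The heights satisfy `p.2 / 2 ≤ 1 / 2 ≤ (q.2 + 1) / 2`, so equality holds throughout. -/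
lemma of_lower_eq_upper {p q : Amb} (hp : p ∈ Cyl) (hq : q ∈ Cyl) (h : lower p = upper q) :
    p.2 = 1 ∧ q.2 = 0 := by
  have h2 : p.2 / 2 = (q.2 + 1) / 2 := congrArg Prod.snd h
  have hp2 : p.2 ≤ 1 := hp.2.2
  have hq2 : 0 ≤ q.2 := hq.2.1
  constructor <;> linarith

namespace TwoComplex.IsGluing

variable {Γ₀ Γ₁ Γ₂ : EmbeddedGraph} {C₁ : TwoComplex Γ₀ Γ₁} {C₂ : TwoComplex Γ₁ Γ₂}
  {C : TwoComplex Γ₀ Γ₂}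

lemma inter_eq_empty {s : Set Amb} {a : ℝ} : s ∩ {p | p.2 = a} = ∅ ↔ ∀ p ∈ s, p.2 ≠ a := by
  simp only [Set.eq_empty_iff_forall_notMem, Set.mem_inter_iff, Set.mem_ofPred_eq, not_and, ne_eq]

lemma cellGluing_faces (h : IsGluing C₁ C₂ C) :
    CellGluing lower upper {p | p.2 = 1} {p | p.2 = 0} (C₁.F : Set (Set Amb)) C₂.F C.F
      (fun e => (C₁.tgtFace e : Set Amb)) (fun e => (C₂.srcFace e : Set Amb)) where
  inj₁ := lower_injective
  inj₂ := upper_injective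
  antichain₁ f hf f' hf' := C₁.eq_of_face_subset hf hf'
  antichain₂ f hf f' hf' := C₂.eq_of_face_subset hf hf'
  nonempty₁ f hf := (C₁.isDisc ⟨f, hf⟩).nonempty
  nonempty₂ f hf := (C₂.isDisc ⟨f, hf⟩).nonempty
  meet₁ f hf hm := (C₁.exists_tgtFace ⟨f, hf⟩ hm).imp fun _ => congrArg Subtype.val
  meet₂ f hf hm := (C₂.exists_srcFace ⟨f, hf⟩ hm).imp fun _ => congrArg Subtype.val
  t_mem e := (C₁.tgtFace e).2
  s_mem e := (C₂.srcFace e).2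
  t_meet e := by
    rw [C₁.tgtFace_inter]
    exact ⟨((Γ₁.src e).1, _), (Γ₁.isArc e).left_mem, rfl⟩
  s_meet e := by
    rw [C₂.srcFace_inter]
    exact ⟨((Γ₁.src e).1, _), (Γ₁.isArc e).left_mem, rfl⟩
  t_inj e e' he := by
    have := C₁.tgtFace_inter e
    simp only at he
    have hne : (e'.1 ×ˢ ({1} : Set ℝ)).Nonempty :=
      ⟨((Γ₁.src e').1, _), (Γ₁.isArc e').left_mem, rfl⟩
    rw [he, C₁.tgtFace_inter, Set.prod_eq_prod_iff_of_nonempty hne] at this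
    exact Subtype.ext this.1.symm
  s_inj e e' he := by
    have := C₂.srcFace_inter e
    simp only at he
    have hne : (e'.1 ×ˢ ({0} : Set ℝ)).Nonempty :=
      ⟨((Γ₁.src e').1, _), (Γ₁.isArc e').left_mem, rfl⟩
    rw [he, C₂.srcFace_inter, Set.prod_eq_prod_iff_of_nonempty hne] at this
    exact Subtype.ext this.1.symm
  glue e := by rw [C₁.tgtFace_inter, C₂.srcFace_inter, lower_image_eq_upper_image]
  overlap f hf g hg p hp q hq e :=
    of_lower_eq_upper (C₁.face_cyl f hf p hp).1 (C₂.face_cyl g hg q hq).1 e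
  mem_iff a := by
    simp only [inter_eq_empty]
    exact h.faces a

lemma cellGluing_edges (h : IsGluing C₁ C₂ C) :
    CellGluing lower upper {p | p.2 = 1} {p | p.2 = 0} C₁.intEdges C₂.intEdges C.intEdges
      (fun v => (C₁.tgtEdge v : Set Amb)) (fun v => (C₂.srcEdge v : Set Amb)) where
  inj₁ := lower_injective
  inj₂ := upper_injective
  antichain₁ f hf f' hf' := C₁.eq_of_edge_subset hf.1 hf'.1
  antichain₂ f hf f' hf' := C₂.eq_of_edge_subset hf.1 hf'.1
  nonempty₁ f hf := ⟨_, C₁.src_mem ⟨f, hf.1⟩⟩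
  nonempty₂ f hf := ⟨_, C₂.src_mem ⟨f, hf.1⟩⟩
  meet₁ f hf hm := (C₁.exists_tgtEdge ⟨f, hf.1⟩ hm hf.2.2).imp fun _ => congrArg Subtype.val
  meet₂ f hf hm := (C₂.exists_srcEdge ⟨f, hf.1⟩ hm hf.2.1).imp fun _ => congrArg Subtype.val
  t_mem v := ⟨(C₁.tgtEdge v).2, C₁.tgtEdge_int v⟩
  s_mem v := ⟨(C₂.srcEdge v).2, C₂.srcEdge_int v⟩
  t_meet v := by
    rw [C₁.tgtEdge_inter]
    exact ⟨(v.1, 1), rfl, rfl⟩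
  s_meet v := by
    rw [C₂.srcEdge_inter]
    exact ⟨(v.1, 0), rfl, rfl⟩
  t_inj v v' hv := by
    have := C₁.tgtEdge_inter v
    simp only at hv
    rw [hv, C₁.tgtEdge_inter] at this
    have hm : (v.1, (1 : ℝ)) ∈ ({v'.1} : Set (Fin 4 → ℝ)) ×ˢ ({1} : Set ℝ) := by
      rw [this]; exact ⟨rfl, rfl⟩
    exact Subtype.ext hm.1
  s_inj v v' hv := by
    have := C₂.srcEdge_inter v
    simp only at hv
    rw [hv, C₂.srcEdge_inter] at this
    have hm : (v.1, (0 : ℝ)) ∈ ({v'.1} : Set (Fin 4 → ℝ)) ×ˢ ({0} : Set ℝ) := by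
      rw [this]; exact ⟨rfl, rfl⟩
    exact Subtype.ext hm.1
  glue v := by rw [C₁.tgtEdge_inter, C₂.srcEdge_inter, lower_image_eq_upper_image]
  overlap f hf g hg p hp q hq e :=
    of_lower_eq_upper (C₁.edge_cyl f hf.1 p hp).1 (C₂.edge_cyl g hg.1 q hq).1 e
  -- The gluing condition speaks of all edges, so being interior has to be compared before and
  -- after. `lower` detects height `0` and never reaches height `1`; `upper` does the reverse. Edges
  -- of `Γ` itself are excluded because they touch the gluing level.
  mem_iff a := by
    simp only [inter_eq_empty]
    constructor
    · rintro ⟨ha, h0, h1⟩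
      rcases (h.edges a).1 ha with ⟨e, he, hm, rfl⟩ | ⟨e, he, hm, rfl⟩ | h
      · refine .inl ⟨e, ⟨he, fun hs => h0 ?_, fun hs => ?_⟩, hm, rfl⟩
        · rintro _ ⟨p, hp, rfl⟩
          have : p.2 = 0 := hs hp
          simp [lower, this]
        · exact hm _ (C₁.src_mem ⟨e, he⟩) (hs (C₁.src_mem ⟨e, he⟩))
      · refine .inr (.inl ⟨e, ⟨he, fun hs => ?_, fun hs => h1 ?_⟩, hm, rfl⟩)
        · exact hm _ (C₂.src_mem ⟨e, he⟩) (hs (C₂.src_mem ⟨e, he⟩))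
        · rintro _ ⟨p, hp, rfl⟩
          have : p.2 = 1 := hs hp
          simp [upper, this]
      · exact .inr (.inr h)
    · rintro (⟨e, ⟨he, h0, h1⟩, hm, rfl⟩ | ⟨e, ⟨he, h0, h1⟩, hm, rfl⟩ | ⟨v, rfl⟩)
      · refine ⟨(h.edges _).2 (.inl ⟨e, he, hm, rfl⟩), fun hs => h0 fun p hp => ?_,
          fun hs => ?_⟩
        · have : p.2 / 2 = 0 := hs ⟨p, hp, rfl⟩
          show p.2 = 0
          linarith
        · have h2 : (C₁.src ⟨e, he⟩).1.2 / 2 = 1 := hs ⟨_, C₁.src_mem ⟨e, he⟩, rfl⟩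
          have := (C₁.edge_cyl e he _ (C₁.src_mem ⟨e, he⟩)).1.2.2
          linarith
      · refine ⟨(h.edges _).2 (.inr (.inl ⟨e, he, hm, rfl⟩)), fun hs => ?_,
          fun hs => h1 fun p hp => ?_⟩
        · have h2 : ((C₂.src ⟨e, he⟩).1.2 + 1) / 2 = 0 := hs ⟨_, C₂.src_mem ⟨e, he⟩, rfl⟩
          have := (C₂.edge_cyl e he _ (C₂.src_mem ⟨e, he⟩)).1.2.1
          linarith
        · have : (p.2 + 1) / 2 = 1 := hs ⟨p, hp, rfl⟩
          show p.2 = 1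
          linarith
      · refine ⟨(h.edges _).2 (.inr (.inr ⟨v, rfl⟩)), ?_⟩
        -- A glued edge contains the point `(v, 1/2)`, so it lies in neither boundary level.
        have hv : lower (v.1, 1) ∈ lower '' (C₁.tgtEdge v : Set Amb) ∪ upper '' C₂.srcEdge v := by
          refine .inl ⟨_, ?_, rfl⟩
          have : (v.1, (1 : ℝ)) ∈ (C₁.tgtEdge v : Set Amb) ∩ {p | p.2 = 1} := by
            rw [C₁.tgtEdge_inter]; exact ⟨rfl, rfl⟩
          exact this.1
        refine ⟨fun hs => ?_, fun hs => ?_⟩ <;>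
        · have := hs hv
          simp [lower] at this

end TwoComplex.IsGluing

/-! ### Incidences and products after gluing -/

namespace CellGluing

variable {X : Type*} {I : Type*} {j₁ j₂ : X → X} {B₁ B₂ : Set X}
  {A₁ A₂ A : Set (Set X)} {t s : I → Set X}

/-- Meant for vertices off the gluing level: no cell of the second side reaches `j₁ p`, so its
incidence with a glued cell is decided on the first side. -/
lemma mem_of_image_mem (h : CellGluing j₁ j₂ B₁ B₂ A₁ A₂ A t s) {f a : Set X} (hf : f ∈ A₁)
    (ha : a ∈ A) (hfa : j₁ '' f ⊆ a) {p : X} (hp : ∀ g ∈ A₂, ∀ q ∈ g, j₁ p ≠ j₂ q)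
    (hpa : j₁ p ∈ a) : p ∈ f := by
  rcases h.eq_of_image_subset hf ha hfa with ⟨-, rfl⟩ | ⟨i, rfl, rfl⟩
  · exact (h.inj₁.mem_set_image).1 hpa
  · rcases hpa with hpa | ⟨q, hq, e⟩
    · exact (h.inj₁.mem_set_image).1 hpa
    · exact absurd e.symm (hp _ (h.s_mem i) q hq)

lemma exists_subset_of_image_mem (h : CellGluing j₁ j₂ B₁ B₂ A₁ A₂ A t s) {a : Set X} (ha : a ∈ A)
    {p : X} (hp : ∀ g ∈ A₂, ∀ q ∈ g, j₁ p ≠ j₂ q) (hpa : j₁ p ∈ a) : ∃ f ∈ A₁, j₁ '' f ⊆ a := by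
  rcases (h.mem_iff a).1 ha with ⟨f, hf, -, rfl⟩ | ⟨g, hg, -, rfl⟩ | ⟨i, rfl⟩
  · exact ⟨f, hf, subset_rfl⟩
  · obtain ⟨q, hq, e⟩ := hpa
    exact absurd e.symm (hp g hg q hq)
  · exact ⟨_, h.t_mem i, Set.subset_union_left⟩

/-- `prod_pushout` for the relation of containment, with the families of sets indexed by finite
types. The second factor on the left is the amplitude of the doubly counted cells, read off on the
second side. -/
lemma prod_mul_prod (h : CellGluing j₁ j₂ B₁ B₂ A₁ A₂ A t s) {Y Y₁ Y₂ R : Type*} [Fintype Y]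
    [Fintype Y₁] [Fintype Y₂] [Fintype I] [CommMonoid R] (u : Y → Set X) (u₁ : Y₁ → Set X)
    (u₂ : Y₂ → Set X) (hu : Function.Injective u) (hu₁ : Function.Injective u₁)
    (hu₂ : Function.Injective u₂) (hA : Set.range u = A) (hA₁ : Set.range u₁ = A₁)
    (hA₂ : Set.range u₂ = A₂) (s' : I → Y₂) (hs : ∀ i, u₂ (s' i) = s i)
    (a : Y → R) (a₁ : Y₁ → R) (a₂ : Y₂ → R) (ha₁ : ∀ x y, j₁ '' u₁ x ⊆ u y → a y = a₁ x)
    (ha₂ : ∀ x y, j₂ '' u₂ x ⊆ u y → a y = a₂ x) :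
    (∏ y, a y) * ∏ i, a₂ (s' i) = (∏ x, a₁ x) * ∏ x, a₂ x := by
  have m : ∀ y, u y ∈ A := fun y => hA ▸ ⟨y, rfl⟩
  have m₁ : ∀ y, u₁ y ∈ A₁ := fun y => hA₁ ▸ ⟨y, rfl⟩
  have m₂ : ∀ y, u₂ y ∈ A₂ := fun y => hA₂ ▸ ⟨y, rfl⟩
  have ht : ∀ i, ∃ y, u₁ y = t i := fun i => by
    have := h.t_mem i
    rwa [← hA₁] at this
  choose t' ht using ht
  refine prod_pushout (fun x y => j₁ '' u₁ x ⊆ u y) (fun x y => j₂ '' u₂ x ⊆ u y) t' s' a a₁ a₂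
    ?_ ?_ ?_ ?_ ?_ ?_ ?_ ?_ ?_ ?_ ha₁ ha₂
  · intro x
    obtain ⟨b, hb, hb'⟩ := h.exists_superset (m₁ x)
    rw [← hA] at hb
    obtain ⟨y, rfl⟩ := hb
    exact ⟨y, hb'⟩
  · intro x
    obtain ⟨b, hb, hb'⟩ := h.symm.exists_superset (m₂ x)
    rw [← hA] at hb
    obtain ⟨y, rfl⟩ := hb
    exact ⟨y, hb'⟩
  · exact fun x x' y e e' => hu₁ (h.subset_unique (m₁ x) (m₁ x') (m y) e e')
  · exact fun x x' y e e' => hu₂ (h.symm.subset_unique (m₂ x) (m₂ x') (m y) e e')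
  · exact fun x y y' e e' => hu (h.superset_unique (m₁ x) (m y) (m y') e e')
  · exact fun x y y' e e' => hu (h.symm.superset_unique (m₂ x) (m y) (m y') e e')
  · intro y
    refine (h.exists_subset (m y)).imp ?_ ?_
    · rintro ⟨f, hf, hf'⟩
      rw [← hA₁] at hf
      obtain ⟨x, rfl⟩ := hf
      exact ⟨x, hf'⟩
    · rintro ⟨f, hf, hf'⟩
      rw [← hA₂] at hf
      obtain ⟨x, rfl⟩ := hf
      exact ⟨x, hf'⟩
  · intro x x' y e e'
    obtain ⟨i, h1, h2⟩ := h.eq_of_image_subset_both (m₁ x) (m₂ x') (m y) e e'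
    exact ⟨i, hu₁ (h1.trans (ht i).symm), hu₂ (h2.trans (hs i).symm)⟩
  · intro i
    have := (h.mem_iff _).2 (.inr (.inr ⟨i, rfl⟩))
    rw [← hA] at this
    obtain ⟨y, hy⟩ := this
    refine ⟨y, ?_, ?_⟩
    · rw [ht, hy]; exact Set.subset_union_left
    · rw [hs, hy]; exact Set.subset_union_right
  · intro i i' e
    exact h.s_inj ((hs i).symm.trans ((congrArg u₂ e).trans (hs i')))

end CellGluing

section

variable {G : Type*} [Group G] [TopologicalSpace G]

/-- An interior vertex of one of two labelled two-complexes sees the same labels after gluing. -/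
lemma FoamLabels.vertexLabel_iso_of_cellGluing {Γ₀ Γ₁ Γ₀' Γ₁' Γ₀'' Γ₁'' : EmbeddedGraph}
    {C₁ : TwoComplex Γ₀ Γ₁} {C₂ : TwoComplex Γ₀' Γ₁'} {C : TwoComplex Γ₀'' Γ₁''}
    {I J : Type*} {j₁ j₂ : Amb → Amb} {B₁ B₂ : Set Amb} {t s : I → Set Amb} {t' s' : J → Set Amb}
    (hE : CellGluing j₁ j₂ B₁ B₂ C₁.intEdges C₂.intEdges C.intEdges t s)
    (hF : CellGluing j₁ j₂ B₁ B₂ (C₁.F : Set (Set Amb)) C₂.F C.F t' s')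
    (hsrc : ∀ (e : C₁.E) (c : C.E), j₁ '' e ⊆ c → (C₁.src e : Amb) ∉ B₁ →
      (C.src c : Amb) = j₁ (C₁.src e))
    (htgt : ∀ (e : C₁.E) (c : C.E), j₁ '' e ⊆ c → (C₁.tgt e : Amb) ∉ B₁ →
      (C.tgt c : Amb) = j₁ (C₁.tgt e))
    (L₁ : FoamLabels G C₁) (L : FoamLabels G C)
    (hρ : ∀ (f : C₁.F) (g : C.F), j₁ '' f ⊆ g → L.ρ g = L₁.ρ f)
    (hι : ∀ (e : C₁.IntEdge) (c : C.IntEdge), j₁ '' e.1 ⊆ c.1 →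
      ∃ φ : C₁.Star e.1 ≃ C.Star c.1, (∀ f, j₁ '' f.1 ⊆ (φ f).1) ∧
        (L₁.edgeLabel e).IsIso (L.edgeLabel c) φ)
    (w : C₁.IntVert) (v : C.IntVert) (hv : (v.1 : Amb) = j₁ w.1) (hw : (w.1 : Amb) ∉ B₁)
    (hov : ∀ q ∈ Cyl, j₁ w.1 ≠ j₂ q) :
    (L₁.vertexLabel w).Iso (L.vertexLabel v) := by
  have hov' : ∀ g ∈ C₂.intEdges, ∀ q ∈ g, j₁ w.1 ≠ j₂ q := fun g hg q hq =>
    hov q (C₂.edge_cyl g hg.1 q hq).1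
  have hs : ∀ (e : C₁.IntEdge) (c : C.IntEdge), j₁ '' (e.1 : Set Amb) ⊆ c.1 →
      C₁.src e.1 = w.1 → C.src c.1 = v.1 := fun e c hc he =>
    Subtype.ext ((hsrc e.1 c.1 hc (he ▸ hw)).trans (he ▸ hv.symm))
  have ht : ∀ (e : C₁.IntEdge) (c : C.IntEdge), j₁ '' (e.1 : Set Amb) ⊆ c.1 →
      C₁.tgt e.1 = w.1 → C.tgt c.1 = v.1 := fun e c hc he =>
    Subtype.ext ((htgt e.1 c.1 hc (he ▸ hw)).trans (he ▸ hv.symm))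
  have hm : ∀ (e : C₁.IntEdge) (c : C.IntEdge), j₁ '' (e.1 : Set Amb) ⊆ c.1 →
      (v.1 : Amb) ∈ (c.1 : Set Amb) → w.1 = C₁.src e.1 ∨ w.1 = C₁.tgt e.1 := fun e c hc hvc =>
    C₁.vert_edge w.1 e.1
      (hE.mem_of_image_mem e.mem_intEdges c.mem_intEdges hc hov' (hv ▸ hvc))
  refine L₁.vertexLabel_iso L w v (fun e c => j₁ '' (e.1 : Set Amb) ⊆ c.1)
    (fun f g => j₁ '' (f : Set Amb) ⊆ g) ?_ ?_ ?_ ?_ ?_ ?_ ?_ ?_ hρ hι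
  -- For the converse, `v ∈ c` forces `w` to be an end of `e`. If it were the target, `c` would have
  -- equal source and target, which is impossible for an arc.
  · refine fun e c hc => ⟨hs e c hc, fun hcv => ?_⟩
    rcases hm e c hc (hcv ▸ C.src_mem c.1) with h | h
    · exact h.symm
    · exact absurd (hcv.trans (ht e c hc h.symm).symm) (C.src_ne_tgt c.1)
  · refine fun e c hc => ⟨ht e c hc, fun hcv => ?_⟩
    rcases hm e c hc (hcv ▸ C.tgt_mem c.1) with h | h
    · exact absurd ((hs e c hc h.symm).trans hcv.symm) (C.src_ne_tgt c.1)
    · exact h.symm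
  · intro e
    obtain ⟨a, ha, h⟩ := hE.exists_superset e.mem_intEdges
    exact ⟨⟨⟨a, ha.1⟩, ha.2⟩, h⟩
  · intro c hc
    have hvc : (v.1 : Amb) ∈ (c.1 : Set Amb) :=
      hc.elim (fun h => h ▸ C.src_mem c.1) fun h => h ▸ C.tgt_mem c.1
    obtain ⟨f, hf, h⟩ := hE.exists_subset_of_image_mem c.mem_intEdges hov' (hv ▸ hvc)
    exact ⟨⟨⟨f, hf.1⟩, hf.2⟩, h⟩
  · exact fun e c c' h h' => C.intEdge_ext
      (hE.superset_unique e.mem_intEdges c.mem_intEdges c'.mem_intEdges h h')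
  · exact fun e e' c h h' => C₁.intEdge_ext
      (hE.subset_unique e.mem_intEdges e'.mem_intEdges c.mem_intEdges h h')
  · exact fun f g g' h h' => Subtype.ext (hF.superset_unique f.2 g.2 g'.2 h h')
  · exact fun f f' g h h' => Subtype.ext (hF.subset_unique f.2 f'.2 g.2 h h')

end

lemma TwoComplex.range_intEdge {Γ₀ Γ₁ : EmbeddedGraph} (C : TwoComplex Γ₀ Γ₁) :
    Set.range (fun e : C.IntEdge => (e.1 : Set Amb)) = C.intEdges := by
  ext e
  exact ⟨fun ⟨c, hc⟩ => hc ▸ c.mem_intEdges, fun h => ⟨⟨⟨e, h.1⟩, h.2⟩, rfl⟩⟩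

/-- `lower` fixes `S³ × {0}` pointwise, and incidences and directions restrict to the lower half. -/
lemma TwoComplex.IsGluing.srcOrientation_eq {Γ₀ Γ₁ Γ₂ : EmbeddedGraph} {C₁ : TwoComplex Γ₀ Γ₁}
    {C₂ : TwoComplex Γ₁ Γ₂} {C : TwoComplex Γ₀ Γ₂} (h : C₁.IsGluing C₂ C) :
    C.srcOrientation = C₁.srcOrientation := by
  have l0 : ∀ x, lower (x, 0) = (x, 0) := fun x => by simp [lower]
  have hedge : C.srcOrientation.edge = C₁.srcOrientation.edge := by
    funext e
    refine decide_eq_decide.2 ?_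
    rw [h.inc₁ (C₁.srcFace e) (C.srcFace e) ⟨e.1 ×ˢ {0}, (C₁.edge_bot e).2 e.2⟩
      ⟨e.1 ×ˢ {0}, (C.edge_bot e).2 e.2⟩ (h.srcFace e) ?_]
    rintro _ ⟨⟨x, t⟩, ⟨hx, rfl⟩, rfl⟩
    rw [l0]
    exact ⟨hx, rfl⟩
  have hvert : C.srcOrientation.vert = C₁.srcOrientation.vert := by
    funext v
    refine decide_eq_decide.2 ?_
    have hs := h.src₁ _ _ (h.srcEdge v)
    have ht := h.tgt₁ _ _ (h.srcEdge v)
    have hv : ((v.1, 0) : Amb) ∈ (C₁.srcEdge v : Set Amb) := by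
      have : ((v.1, 0) : Amb) ∈ (C₁.srcEdge v : Set Amb) ∩ {p | p.2 = 0} := by
        rw [C₁.srcEdge_inter]; exact ⟨rfl, rfl⟩
      exact this.1
    -- `(v, 0)` is one of the ends of `e_v`. If it is the source, the source carries over to `C`; if
    -- it is the target, the target does, and then `(v, 0)` is the source in neither complex.
    rcases C₁.vert_edge ⟨_, (C₁.vert_bot _).2 v.2⟩ (C₁.srcEdge v) hv with h' | h'
    · have h' : ((v.1, 0) : Amb) = C₁.src (C₁.srcEdge v) := congrArg Subtype.val h'
      rw [← h'] at hs
      rw [hs (by simp), ← h', l0]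
    · have h' : ((v.1, 0) : Amb) = C₁.tgt (C₁.srcEdge v) := congrArg Subtype.val h'
      rw [← h', l0] at ht
      have ht := ht (by simp)
      constructor
      · intro h3
        exact absurd (Subtype.ext (h3.trans ht.symm)) (C.src_ne_tgt _)
      · intro h3
        exact absurd (Subtype.ext (h3.trans h')) (C₁.src_ne_tgt _)
  unfold TwoComplex.srcOrientation at *
  simp only at hedge hvert
  rw [hedge, hvert]

/-! ### Multiplicativity of the amplitudes under gluing -/

namespace TopspinFoam.IsGluing

variable {G : Type*} [Group G] [TopologicalSpace G] {n : ℕ} {ψ₀ ψ₁ ψ₂ : TopspinNetwork G n}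
  {Ψ₁ : TopspinFoam ψ₀ ψ₁} {Ψ₂ : TopspinFoam ψ₁ ψ₂} {Ψ : TopspinFoam ψ₀ ψ₂}

lemma vertexLabel_lower (h : IsGluing Ψ₁ Ψ₂ Ψ) (w : Ψ₁.cx.IntVert) (v : Ψ.cx.IntVert)
    (hv : (v.1 : Amb) = lower w.1) :
    (Ψ₁.labels.vertexLabel w).Iso (Ψ.labels.vertexLabel v) :=
  FoamLabels.vertexLabel_iso_of_cellGluing h.cx.cellGluing_edges h.cx.cellGluing_faces
    h.cx.src₁ h.cx.tgt₁ Ψ₁.labels Ψ.labels h.ρ₁ h.ι₁ w v hv w.2.2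
    fun _ hq e => w.2.2 (of_lower_eq_upper (Ψ₁.cx.vert_cyl _ w.1.2).1 hq e).1

lemma vertexLabel_upper (h : IsGluing Ψ₁ Ψ₂ Ψ) (w : Ψ₂.cx.IntVert) (v : Ψ.cx.IntVert)
    (hv : (v.1 : Amb) = upper w.1) :
    (Ψ₂.labels.vertexLabel w).Iso (Ψ.labels.vertexLabel v) :=
  FoamLabels.vertexLabel_iso_of_cellGluing h.cx.cellGluing_edges.symm h.cx.cellGluing_faces.symm
    h.cx.src₂ h.cx.tgt₂ Ψ₂.labels Ψ.labels h.ρ₂ h.ι₂ w v hv w.2.1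
    fun _ hq e => w.2.1 (of_lower_eq_upper hq (Ψ₂.cx.vert_cyl _ w.1.2).1 e.symm).2

end TopspinFoam.IsGluing

namespace SpinFoamModel

variable {G : Type*} [Group G] [TopologicalSpace G] (M : SpinFoamModel G) {n : ℕ}
  {ψ₀ ψ₁ ψ₂ : TopspinNetwork G n} {Ψ₁ : TopspinFoam ψ₀ ψ₁} {Ψ₂ : TopspinFoam ψ₁ ψ₂}
  {Ψ : TopspinFoam ψ₀ ψ₂}

lemma sourceAmplitude_of_isGluing (h : TopspinFoam.IsGluing Ψ₁ Ψ₂ Ψ) :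
    M.sourceAmplitude Ψ = M.sourceAmplitude Ψ₁ := by
  unfold sourceAmplitude
  rw [h.cx.srcOrientation_eq]

/-- The glued faces are counted twice on the right. The boundary condition `face_bot` of `Ψ₂`
identifies the surplus with the face part of its source amplitude. -/
lemma prod_faceAmp_of_isGluing (h : TopspinFoam.IsGluing Ψ₁ Ψ₂ Ψ) :
    (∏ f : Ψ.cx.F, M.faceAmp (Ψ.labels.ρ f)) *
        ∏ e : ψ₁.graph.E, M.faceAmp ((ψ₁.ρ e).orient (Ψ₂.cx.srcOrientation.edge e)) =
      (∏ f : Ψ₁.cx.F, M.faceAmp (Ψ₁.labels.ρ f)) * ∏ f : Ψ₂.cx.F, M.faceAmp (Ψ₂.labels.ρ f) := by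
  simp only [← Ψ₂.face_bot]
  exact h.cx.cellGluing_faces.prod_mul_prod Subtype.val Subtype.val Subtype.val
    Subtype.val_injective Subtype.val_injective Subtype.val_injective
    Subtype.range_val Subtype.range_val Subtype.range_val Ψ₂.cx.srcFace (fun _ => rfl)
    (fun f => M.faceAmp (Ψ.labels.ρ f)) (fun f => M.faceAmp (Ψ₁.labels.ρ f))
    (fun f => M.faceAmp (Ψ₂.labels.ρ f)) (fun f g hfg => by rw [h.ρ₁ f g hfg])
    fun f g hfg => by rw [h.ρ₂ f g hfg]

-- As for faces, except that edge labels agree only up to renaming the adjacent faces, so the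
-- invariance `edgeAmp_iso` is needed.
open scoped Classical in
lemma prod_edgeAmp_of_isGluing (h : TopspinFoam.IsGluing Ψ₁ Ψ₂ Ψ) :
    (∏ e : Ψ.cx.IntEdge, M.edgeAmp (Ψ.labels.edgeLabel e)) *
        ∏ v : ψ₁.graph.V, M.edgeAmp (ψ₁.collarLabel Ψ₂.cx.srcOrientation v) =
      (∏ e : Ψ₁.cx.IntEdge, M.edgeAmp (Ψ₁.labels.edgeLabel e)) *
        ∏ e : Ψ₂.cx.IntEdge, M.edgeAmp (Ψ₂.labels.edgeLabel e) := by
  have hb : ∀ v, M.edgeAmp (ψ₁.collarLabel Ψ₂.cx.srcOrientation v) =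
      M.edgeAmp (Ψ₂.labels.edgeLabel ⟨_, Ψ₂.cx.srcEdge_int v⟩) := fun v => by
    obtain ⟨φ, -, hφ⟩ := Ψ₂.edge_bot v
    exact M.edgeAmp_iso _ _ φ hφ
  simp only [hb]
  refine h.cx.cellGluing_edges.prod_mul_prod (fun e => (e.1 : Set Amb)) (fun e => (e.1 : Set Amb))
    (fun e => (e.1 : Set Amb)) (fun _ _ => TwoComplex.intEdge_ext _)
    (fun _ _ => TwoComplex.intEdge_ext _) (fun _ _ => TwoComplex.intEdge_ext _)
    Ψ.cx.range_intEdge Ψ₁.cx.range_intEdge Ψ₂.cx.range_intEdge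
    (fun v => ⟨_, Ψ₂.cx.srcEdge_int v⟩) (fun _ => rfl) (fun e => M.edgeAmp (Ψ.labels.edgeLabel e))
    (fun e => M.edgeAmp (Ψ₁.labels.edgeLabel e)) (fun e => M.edgeAmp (Ψ₂.labels.edgeLabel e))
    (fun e c hc => ?_) fun e c hc => ?_
  · obtain ⟨φ, -, hφ⟩ := h.ι₁ e c hc
    exact (M.edgeAmp_iso _ _ φ hφ).symm
  · obtain ⟨φ, -, hφ⟩ := h.ι₂ e c hc
    exact (M.edgeAmp_iso _ _ φ hφ).symm

open scoped Classical in
lemma prod_vertexAmp_of_isGluing (h : TopspinFoam.IsGluing Ψ₁ Ψ₂ Ψ) :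
    ∏ v : Ψ.cx.IntVert, M.vertexAmp (Ψ.labels.vertexLabel v) =
      (∏ v : Ψ₁.cx.IntVert, M.vertexAmp (Ψ₁.labels.vertexLabel v)) *
        ∏ v : Ψ₂.cx.IntVert, M.vertexAmp (Ψ₂.labels.vertexLabel v) := by
  have cyl₁ : ∀ w : Ψ₁.cx.IntVert, 0 ≤ w.1.1.2 ∧ w.1.1.2 ≤ 1 := fun w =>
    (Ψ₁.cx.vert_cyl _ w.1.2).1.2
  have cyl₂ : ∀ w : Ψ₂.cx.IntVert, 0 ≤ w.1.1.2 ∧ w.1.1.2 ≤ 1 := fun w =>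
    (Ψ₂.cx.vert_cyl _ w.1.2).1.2
  -- The vertices of `Γ` are not vertices of the glued complex, so nothing is counted twice and the
  -- pushout is a disjoint union.
  have := prod_pushout (I := Empty)
    (fun (w : Ψ₁.cx.IntVert) (v : Ψ.cx.IntVert) => (v.1 : Amb) = lower w.1)
    (fun (w : Ψ₂.cx.IntVert) (v : Ψ.cx.IntVert) => (v.1 : Amb) = upper w.1) Empty.elim Empty.elim
    (fun v => M.vertexAmp (Ψ.labels.vertexLabel v))
    (fun v => M.vertexAmp (Ψ₁.labels.vertexLabel v))
    (fun v => M.vertexAmp (Ψ₂.labels.vertexLabel v)) ?_ ?_ ?_ ?_ ?_ ?_ ?_ ?_ ?_ ?_ ?_ ?_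
  · simpa using this
  · intro w
    refine ⟨⟨⟨lower w.1, (h.cx.verts _).2 (.inl ⟨_, w.1.2, w.2.2, rfl⟩)⟩, fun e => w.2.1 ?_,
      fun e => ?_⟩, rfl⟩
    · have : w.1.1.2 / 2 = 0 := e
      linarith
    · have : w.1.1.2 / 2 = 1 := e
      linarith [(cyl₁ w).2]
  · intro w
    refine ⟨⟨⟨upper w.1, (h.cx.verts _).2 (.inr ⟨_, w.1.2, w.2.1, rfl⟩)⟩, fun e => ?_,
      fun e => w.2.2 ?_⟩, rfl⟩
    · have : (w.1.1.2 + 1) / 2 = 0 := e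
      linarith [(cyl₂ w).1]
    · have : (w.1.1.2 + 1) / 2 = 1 := e
      linarith
  · exact fun w w' v e e' => Subtype.ext (Subtype.ext (lower_injective (e.symm.trans e')))
  · exact fun w w' v e e' => Subtype.ext (Subtype.ext (upper_injective (e.symm.trans e')))
  · exact fun w v v' e e' => Subtype.ext (Subtype.ext (e.trans e'.symm))
  · exact fun w v v' e e' => Subtype.ext (Subtype.ext (e.trans e'.symm))
  · intro v
    refine ((h.cx.verts _).1 v.1.2).imp ?_ ?_
    · rintro ⟨w, hw, h1, e⟩
      refine ⟨⟨⟨w, hw⟩, fun h0 => v.2.1 ?_, h1⟩, e⟩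
      have h0 : w.2 = 0 := h0
      simp [e, lower, h0]
    · rintro ⟨w, hw, h0, e⟩
      refine ⟨⟨⟨w, hw⟩, h0, fun h1 => v.2.2 ?_⟩, e⟩
      have h1 : w.2 = 1 := h1
      simp [e, upper, h1]
  · intro w w' v e e'
    exact absurd (of_lower_eq_upper (Ψ₁.cx.vert_cyl _ w.1.2).1 (Ψ₂.cx.vert_cyl _ w'.1.2).1
      (e.symm.trans e')).1 w.2.2
  · exact fun i => i.elim
  · exact fun i => i.elim
  · exact fun w v e => (M.vertexAmp_iso _ _ (h.vertexLabel_lower w v e)).symm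
  · exact fun w v e => (M.vertexAmp_iso _ _ (h.vertexLabel_upper w v e)).symm

open scoped Classical in
/-- The normalized amplitude is multiplicative under gluing. -/
lemma normAmplitude_of_isGluing (hω : M.WeightMultiplicative) (h : TopspinFoam.IsGluing Ψ₁ Ψ₂ Ψ)
    (h₁ : M.sourceAmplitude Ψ₁ ≠ 0) (h₂ : M.sourceAmplitude Ψ₂ ≠ 0) :
    M.normAmplitude Ψ = M.normAmplitude Ψ₁ * M.normAmplitude Ψ₂ := by
  -- The identity before division; the source amplitude of `Ψ₂` supplies both the face and the edge
  -- correction.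
  have key : M.amplitude Ψ * M.sourceAmplitude Ψ₂ = M.amplitude Ψ₁ * M.amplitude Ψ₂ := by
    have hf := M.prod_faceAmp_of_isGluing h
    have he := M.prod_edgeAmp_of_isGluing h
    unfold amplitude sourceAmplitude networkAmplitude
    rw [hω _ _ _ h.cx, M.prod_vertexAmp_of_isGluing h]
    linear_combination M.weight Ψ₁.cx * M.weight Ψ₂.cx *
      (∏ v : Ψ₁.cx.IntVert, M.vertexAmp (Ψ₁.labels.vertexLabel v)) *
      (∏ v : Ψ₂.cx.IntVert, M.vertexAmp (Ψ₂.labels.vertexLabel v)) *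
      ((∏ e : Ψ.cx.IntEdge, M.edgeAmp (Ψ.labels.edgeLabel e)) *
        (∏ v : ψ₁.graph.V, M.edgeAmp (ψ₁.collarLabel Ψ₂.cx.srcOrientation v)) * hf +
      (∏ f : Ψ₁.cx.F, M.faceAmp (Ψ₁.labels.ρ f)) * (∏ f : Ψ₂.cx.F, M.faceAmp (Ψ₂.labels.ρ f)) * he)
  unfold normAmplitude
  rw [M.sourceAmplitude_of_isGluing h, div_mul_div_comm, div_eq_div_iff h₁ (mul_ne_zero h₁ h₂)]
  linear_combination M.sourceAmplitude Ψ₁ * key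

end SpinFoamModel

/-! ### Invariance of the amplitudes under equivalence -/

lemma prod_eq_of_relation {X Y R : Type*} [Fintype X] [Fintype Y] [CommMonoid R]
    (r : X → Y → Prop) (a : X → R) (b : Y → R) (ex : ∀ x, ∃ y, r x y) (ex' : ∀ y, ∃ x, r x y)
    (inj : ∀ x x' y, r x y → r x' y → x = x') (uniq : ∀ x y y', r x y → r x y' → y = y')
    (hab : ∀ x y, r x y → a x = b y) : ∏ x, a x = ∏ y, b y := by
  choose k hk using ex
  refine Fintype.prod_bijective k ⟨fun x x' e => inj _ _ _ (hk x) (e ▸ hk x'), fun y => ?_⟩ a b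
    fun x => hab _ _ (hk x)
  obtain ⟨x, hx⟩ := ex' y
  exact ⟨x, uniq x _ _ (hk x) hx⟩

namespace TwoComplex.IsIsoVia

variable {Γ₀ Γ₁ : EmbeddedGraph} {C C' : TwoComplex Γ₀ Γ₁} {h : Amb → Amb}

lemma image_inj (H : IsIsoVia h C C') {s t : Set Amb} (hs : s ⊆ Cyl) (ht : t ⊆ Cyl)
    (e : h '' s = h '' t) : s = t :=
  (H.bijOn.injOn.image_eq_image_iff hs ht).1 e

lemma edge_subset_cyl (C : TwoComplex Γ₀ Γ₁) (e : C.E) : (e : Set Amb) ⊆ Cyl :=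
  fun p hp => (C.edge_cyl e e.2 p hp).1

lemma face_subset_cyl (C : TwoComplex Γ₀ Γ₁) (f : C.F) : (f : Set Amb) ⊆ Cyl :=
  fun p hp => (C.face_cyl f f.2 p hp).1

/-- If `h p` is at height `0`, it is its own image under `h`, since `h` is the identity there;
injectivity then gives `p = h p`. Hence `h` preserves interior edges and vertices. -/
lemma height_eq_zero_iff (H : IsIsoVia h C C') {p : Amb} (hp : p ∈ Cyl) :
    (h p).2 = 0 ↔ p.2 = 0 := by
  obtain ⟨x, t⟩ := p
  constructor
  · intro h0
    have hc := (H.bijOn.mapsTo hp).1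
    have e : h ((h (x, t)).1, 0) = h (x, t) := (H.bot _ hc).trans (Prod.ext rfl h0.symm)
    have hq : ((h (x, t)).1, (0 : ℝ)) ∈ Cyl := ⟨hc, by simp⟩
    exact (congrArg Prod.snd (H.bijOn.injOn hq hp e)).symm
  · rintro rfl
    rw [H.bot x hp.1]

lemma height_eq_one_iff (H : IsIsoVia h C C') {p : Amb} (hp : p ∈ Cyl) :
    (h p).2 = 1 ↔ p.2 = 1 := by
  obtain ⟨x, t⟩ := p
  constructor
  · intro h0
    have hc := (H.bijOn.mapsTo hp).1
    have e : h ((h (x, t)).1, 1) = h (x, t) := (H.top _ hc).trans (Prod.ext rfl h0.symm)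
    have hq : ((h (x, t)).1, (1 : ℝ)) ∈ Cyl := ⟨hc, by simp⟩
    exact (congrArg Prod.snd (H.bijOn.injOn hq hp e)).symm
  · rintro rfl
    rw [H.top x hp.1]

lemma image_mem_intEdges (H : IsIsoVia h C C') (e : Set Amb) (he : e ∈ C.E) :
    h '' e ∈ C'.intEdges ↔ e ∈ C.intEdges := by
  have hE : h '' e ∈ C'.E := by
    have : h '' e ∈ (C'.E : Set (Set Amb)) := by rw [H.edges]; exact ⟨e, he, rfl⟩
    exact this
  have hc := edge_subset_cyl C ⟨e, he⟩
  have h0 : h '' e ⊆ {p | p.2 = 0} ↔ e ⊆ {p | p.2 = 0} := by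
    rw [Set.image_subset_iff]
    exact forall₂_congr fun p hp => H.height_eq_zero_iff (hc hp)
  have h1 : h '' e ⊆ {p | p.2 = 1} ↔ e ⊆ {p | p.2 = 1} := by
    rw [Set.image_subset_iff]
    exact forall₂_congr fun p hp => H.height_eq_one_iff (hc hp)
  simp only [intEdges, Set.mem_ofPred_eq, h0, h1, he, hE, true_and]

lemma exists_intEdge (H : IsIsoVia h C C') (e : C.IntEdge) :
    ∃ e' : C'.IntEdge, (e'.1 : Set Amb) = h '' e.1 := by
  have := (H.image_mem_intEdges _ e.1.2).2 e.mem_intEdges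
  exact ⟨⟨⟨_, this.1⟩, this.2⟩, rfl⟩

lemma exists_intEdge' (H : IsIsoVia h C C') (e' : C'.IntEdge) :
    ∃ e : C.IntEdge, (e'.1 : Set Amb) = h '' e.1 := by
  have : (e'.1 : Set Amb) ∈ (C'.E : Set (Set Amb)) := e'.1.2
  rw [H.edges] at this
  obtain ⟨e, he, hee : h '' e = e'.1⟩ := this
  have := (H.image_mem_intEdges e he).1 (hee ▸ e'.mem_intEdges)
  exact ⟨⟨⟨e, this.1⟩, this.2⟩, hee.symm⟩

lemma src_eq_iff (H : IsIsoVia h C C') {e : C.E} {e' : C'.E} (he : (e' : Set Amb) = h '' e)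
    {v : C.V} {v' : C'.V} (hv : (v' : Amb) = h v) : C'.src e' = v' ↔ C.src e = v := by
  rw [Subtype.ext_iff, Subtype.ext_iff, H.src e e' he, hv]
  exact H.bijOn.injOn.eq_iff (C.vert_cyl _ (C.src e).2).1 (C.vert_cyl _ v.2).1

lemma tgt_eq_iff (H : IsIsoVia h C C') {e : C.E} {e' : C'.E} (he : (e' : Set Amb) = h '' e)
    {v : C.V} {v' : C'.V} (hv : (v' : Amb) = h v) : C'.tgt e' = v' ↔ C.tgt e = v := by
  rw [Subtype.ext_iff, Subtype.ext_iff, H.tgt e e' he, hv]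
  exact H.bijOn.injOn.eq_iff (C.vert_cyl _ (C.tgt e).2).1 (C.vert_cyl _ v.2).1

/-- `h` is the identity at the bottom, so the edges and vertices of `Γ₀` are their own images, and
`h` preserves incidences and sources. -/
lemma srcOrientation_eq (H : IsIsoVia h C C') : C'.srcOrientation = C.srcOrientation := by
  have hedge : C'.srcOrientation.edge = C.srcOrientation.edge := by
    funext e
    refine decide_eq_decide.2 ?_
    rw [H.inc (C.srcFace e) (C'.srcFace e) ⟨e.1 ×ˢ {0}, (C.edge_bot e).2 e.2⟩
      ⟨e.1 ×ˢ {0}, (C'.edge_bot e).2 e.2⟩ (H.srcFace e) ?_]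
    have : Set.EqOn h id (e.1 ×ˢ ({0} : Set ℝ)) := by
      rintro ⟨x, t⟩ ⟨hx, rfl⟩
      exact H.bot x (Γ₀.edge_sphere e e.2 x hx).1
    exact (this.image_eq.trans (Set.image_id _)).symm
  have hvert : C'.srcOrientation.vert = C.srcOrientation.vert := by
    funext v
    refine decide_eq_decide.2 ?_
    have := H.src_eq_iff (H.srcEdge v) (v := ⟨(v.1, 0), (C.vert_bot _).2 v.2⟩)
      (v' := ⟨(v.1, 0), (C'.vert_bot _).2 v.2⟩) (H.bot _ (Γ₀.vert_sphere _ v.2).1).symm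
    simpa only [Subtype.ext_iff] using this
  unfold TwoComplex.srcOrientation at *
  simp only at hedge hvert
  rw [hedge, hvert]

end TwoComplex.IsIsoVia

namespace SpinFoamModel

open TwoComplex.IsIsoVia in
open scoped Classical in
/-- The normalized amplitude is well defined on equivalence classes. -/
lemma normAmplitude_eq_of_equivalent {G : Type*} [Group G] [TopologicalSpace G]
    (M : SpinFoamModel G) {n : ℕ} {ψ₀ ψ₁ : TopspinNetwork G n} {Ψ Ψ' : TopspinFoam ψ₀ ψ₁}
    (H : Ψ.Equivalent Ψ') : M.normAmplitude Ψ = M.normAmplitude Ψ' := by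
  obtain ⟨h, H, hρ, hι, -⟩ := H
  have uniqE : ∀ (e : Ψ.cx.IntEdge) (e₁ e₂ : Ψ'.cx.IntEdge), (e₁.1 : Set Amb) = h '' e.1 →
      (e₂.1 : Set Amb) = h '' e.1 → e₁ = e₂ := fun _ _ _ h₁ h₂ =>
    Ψ'.cx.intEdge_ext (h₁.trans h₂.symm)
  have injE : ∀ (e₁ e₂ : Ψ.cx.IntEdge) (e : Ψ'.cx.IntEdge), (e.1 : Set Amb) = h '' e₁.1 →
      (e.1 : Set Amb) = h '' e₂.1 → e₁ = e₂ := fun e₁ e₂ _ h₁ h₂ =>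
    Ψ.cx.intEdge_ext
      (H.image_inj (edge_subset_cyl _ e₁.1) (edge_subset_cyl _ e₂.1) (h₁.symm.trans h₂))
  have uniqF : ∀ (f : Ψ.cx.F) (f₁ f₂ : Ψ'.cx.F), (f₁ : Set Amb) = h '' f →
      (f₂ : Set Amb) = h '' f → f₁ = f₂ := fun _ _ _ h₁ h₂ => Subtype.ext (h₁.trans h₂.symm)
  have injF : ∀ (f₁ f₂ : Ψ.cx.F) (f : Ψ'.cx.F), (f : Set Amb) = h '' f₁ →
      (f : Set Amb) = h '' f₂ → f₁ = f₂ := fun f₁ f₂ _ h₁ h₂ => Subtype.ext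
    (H.image_inj (face_subset_cyl _ f₁) (face_subset_cyl _ f₂) (h₁.symm.trans h₂))
  have cyl : ∀ v : Ψ.cx.V, (v : Amb) ∈ Cyl := fun v => (Ψ.cx.vert_cyl _ v.2).1
  have hF : ∏ f : Ψ.cx.F, M.faceAmp (Ψ.labels.ρ f) = ∏ f : Ψ'.cx.F, M.faceAmp (Ψ'.labels.ρ f) := by
    refine prod_eq_of_relation (fun (f : Ψ.cx.F) (f' : Ψ'.cx.F) => (f' : Set Amb) = h '' f)
      _ _ (fun f => ?_)
      (fun f' => ?_) injF uniqF fun f f' hf => by rw [hρ f f' hf]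
    · have : h '' (f : Set Amb) ∈ (Ψ'.cx.F : Set (Set Amb)) := by
        rw [H.faces]; exact ⟨f, f.2, rfl⟩
      exact ⟨⟨_, this⟩, rfl⟩
    · have : (f' : Set Amb) ∈ (Ψ'.cx.F : Set (Set Amb)) := f'.2
      rw [H.faces] at this
      obtain ⟨f, hf, e⟩ := this
      exact ⟨⟨f, hf⟩, e.symm⟩
  have hE : ∏ e : Ψ.cx.IntEdge, M.edgeAmp (Ψ.labels.edgeLabel e) =
      ∏ e : Ψ'.cx.IntEdge, M.edgeAmp (Ψ'.labels.edgeLabel e) := by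
    refine prod_eq_of_relation (fun (e : Ψ.cx.IntEdge) (e' : Ψ'.cx.IntEdge) =>
      (e'.1 : Set Amb) = h '' e.1) _ _ H.exists_intEdge
      H.exists_intEdge' injE uniqE fun e e' he => ?_
    obtain ⟨φ, -, hφ⟩ := hι e e' he
    exact M.edgeAmp_iso _ _ φ hφ
  have hV : ∏ v : Ψ.cx.IntVert, M.vertexAmp (Ψ.labels.vertexLabel v) =
      ∏ v : Ψ'.cx.IntVert, M.vertexAmp (Ψ'.labels.vertexLabel v) := by
    refine prod_eq_of_relation (fun (v : Ψ.cx.IntVert) (v' : Ψ'.cx.IntVert) =>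
      (v'.1 : Amb) = h v.1) _ _ (fun v => ?_)
      (fun v' => ?_) (fun v₁ v₂ v h₁ h₂ => Subtype.ext (Subtype.ext
        (H.bijOn.injOn (cyl _) (cyl _) (h₁.symm.trans h₂))))
      (fun v v₁ v₂ h₁ h₂ => Subtype.ext (Subtype.ext (h₁.trans h₂.symm))) fun v v' hv => ?_
    · have : h v.1 ∈ (Ψ'.cx.V : Set Amb) := by
        rw [H.verts]; exact ⟨_, v.1.2, rfl⟩
      exact ⟨⟨⟨_, this⟩, fun e => v.2.1 ((H.height_eq_zero_iff (cyl _)).1 e),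
        fun e => v.2.2 ((H.height_eq_one_iff (cyl _)).1 e)⟩, rfl⟩
    · have : (v'.1 : Amb) ∈ (Ψ'.cx.V : Set Amb) := v'.1.2
      rw [H.verts] at this
      obtain ⟨v, hv, e⟩ := this
      exact ⟨⟨⟨v, hv⟩, fun e0 => v'.2.1 (e ▸ (H.height_eq_zero_iff (cyl ⟨v, hv⟩)).2 e0),
        fun e1 => v'.2.2 (e ▸ (H.height_eq_one_iff (cyl ⟨v, hv⟩)).2 e1)⟩, e.symm⟩
    · exact M.vertexAmp_iso _ _ (Ψ.labels.vertexLabel_iso Ψ'.labels v v'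
        (fun e e' => (e'.1 : Set Amb) = h '' e.1) (fun f f' => (f' : Set Amb) = h '' f)
        (fun e e' he => (H.src_eq_iff he hv).symm) (fun e e' he => (H.tgt_eq_iff he hv).symm)
        H.exists_intEdge (fun e' _ => H.exists_intEdge' e') uniqE injE uniqF injF hρ hι)
  unfold normAmplitude amplitude sourceAmplitude
  rw [H.srcOrientation_eq, hF, hE, hV, M.weight_iso _ _ h H]

/-! ### The time evolution on the semigroupoid algebra -/

variable {G : Type*} [Group G] [TopologicalSpace G] (M : SpinFoamModel G)

/-- The normalized amplitude of an arrow of the semigroupoid. -/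
def arrowAmplitude (c : Arrow G) : ℂ :=
  Quot.lift (fun Ψ : TopspinFoam c.2.1 c.2.2.1 => M.normAmplitude Ψ)
    (fun _ _ => M.normAmplitude_eq_of_equivalent) c.2.2.2

lemma arrowAmplitude_arrow {n : ℕ} {ψ₀ ψ₁ : TopspinNetwork G n} (Ψ : TopspinFoam ψ₀ ψ₁) :
    M.arrowAmplitude Ψ.arrow = M.normAmplitude Ψ := rfl

variable {M}

lemma HasPositiveAmplitudes.arrowAmplitude_pos (hM : M.HasPositiveAmplitudes) (c : Arrow G) :
    ∃ r : ℝ, 0 < r ∧ M.arrowAmplitude c = r := by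
  obtain ⟨n, ψ₀, ψ₁, ⟨Ψ⟩⟩ := c
  obtain ⟨⟨r, hr, h⟩, s, hs, h'⟩ := hM Ψ
  refine ⟨r / s, div_pos hr hs, ?_⟩
  change M.amplitude Ψ / M.sourceAmplitude Ψ = _
  rw [h, h', Complex.ofReal_div]

lemma HasPositiveAmplitudes.arrowAmplitude_ne_zero (hM : M.HasPositiveAmplitudes) (c : Arrow G) :
    M.arrowAmplitude c ≠ 0 := by
  obtain ⟨r, hr, h⟩ := hM.arrowAmplitude_pos c
  rw [h]
  exact_mod_cast hr.ne'

lemma HasPositiveAmplitudes.sourceAmplitude_ne_zero (hM : M.HasPositiveAmplitudes) {n : ℕ}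
    {ψ₀ ψ₁ : TopspinNetwork G n} (Ψ : TopspinFoam ψ₀ ψ₁) : M.sourceAmplitude Ψ ≠ 0 := by
  obtain ⟨-, r, hr, h⟩ := hM Ψ
  rw [h]
  exact_mod_cast hr.ne'

/-- Positivity enters here: `(xy)^z = x^z y^z` may fail for general complex bases because of the
branch of the logarithm. -/
lemma HasPositiveAmplitudes.arrowAmplitude_cpow_mul (hM : M.HasPositiveAmplitudes)
    (hω : M.WeightMultiplicative) {a b c : Arrow G} (h : IsComposite a b c) (z : ℂ) :
    M.arrowAmplitude c ^ z = M.arrowAmplitude a ^ z * M.arrowAmplitude b ^ z := by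
  have hmul : M.arrowAmplitude c = M.arrowAmplitude a * M.arrowAmplitude b := by
    -- Any representatives that glue may be used, since the amplitude of an arrow depends only on
    -- its class.
    obtain ⟨Ψ₁, Ψ₂, Ψ, h⟩ := h
    exact M.normAmplitude_of_isGluing hω h (hM.sourceAmplitude_ne_zero Ψ₁)
      (hM.sourceAmplitude_ne_zero Ψ₂)
  obtain ⟨r, hr, ha⟩ := hM.arrowAmplitude_pos a
  obtain ⟨s, hs, hb⟩ := hM.arrowAmplitude_pos b
  rw [hmul, ha, hb, Complex.mul_cpow_ofReal_nonneg hr.le hs.le]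

variable (M)

/-- The operators `f ↦ (A⁰)^{it} f`. -/
def evolution (t : ℝ) : (Arrow G → ℂ) →ₗ[ℂ] (Arrow G → ℂ) where
  toFun f c := M.arrowAmplitude c ^ (Complex.I * t) * f c
  map_add' f g := by
    funext c
    simp [mul_add]
  map_smul' z f := by
    funext c
    simp [mul_left_comm]

lemma evolution_apply (t : ℝ) (f : Arrow G → ℂ) (c : Arrow G) :
    M.evolution t f c = M.arrowAmplitude c ^ (Complex.I * t) * f c := rfl

lemma isTimeEvolution_evolution (hω : M.WeightMultiplicative) (hM : M.HasPositiveAmplitudes) :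
    IsTimeEvolution M.evolution where
  finite_support t f hf := hf.subset fun c hc => right_ne_zero_of_mul hc
  zero := by
    ext f c
    simp [evolution_apply]
  add s t := by
    refine LinearMap.ext fun f => funext fun c => ?_
    simp only [LinearMap.comp_apply, evolution_apply, Complex.ofReal_add, mul_add]
    rw [Complex.cpow_add _ _ (hM.arrowAmplitude_ne_zero c), mul_assoc]
  mul t f₁ f₂ _ _ := by
    funext c
    -- The factor depends only on `c`, so it moves inside the sum and splits over each decomposition
    -- of `c`. A scalar also passes through `∑ᶠ` when this takes its default value `0`.
    rw [evolution_apply, conv, conv, ← smul_eq_mul, smul_finsum]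
    refine finsum_congr fun p => ?_
    split_ifs with h
    · rw [smul_eq_mul, hM.arrowAmplitude_cpow_mul hω h, evolution_apply, evolution_apply]
      ring
    · exact smul_zero _
  continuous f c := by
    simp only [evolution_apply]
    exact (Continuous.const_cpow (by fun_prop) (.inl (hM.arrowAmplitude_ne_zero c))).mul
      continuous_const

end SpinFoamModel

end SpinFoam

end

theorem mainTheorem7 {G : Type*} [Group G] [TopologicalSpace G] [IsTopologicalGroup G]
    [CompactSpace G] (M : SpinFoam.SpinFoamModel G) (hω : M.WeightMultiplicative) :
    (∀ {n : ℕ} {ψ₀ ψ₁ ψ₂ : SpinFoam.TopspinNetwork G n} (Ψ₁ : SpinFoam.TopspinFoam ψ₀ ψ₁)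
      (Ψ₂ : SpinFoam.TopspinFoam ψ₁ ψ₂)
      (Ψ : SpinFoam.TopspinFoam ψ₀ ψ₂), SpinFoam.TopspinFoam.IsGluing Ψ₁ Ψ₂ Ψ →
        M.sourceAmplitude Ψ₁ ≠ 0 → M.sourceAmplitude Ψ₂ ≠ 0 →
          M.normAmplitude Ψ = M.normAmplitude Ψ₁ * M.normAmplitude Ψ₂) ∧
    (M.HasPositiveAmplitudes →
      ∃ σ : ℝ → (SpinFoam.Arrow G → ℂ) →ₗ[ℂ] (SpinFoam.Arrow G → ℂ),
        (∀ (t : ℝ) (f : SpinFoam.Arrow G → ℂ) {n : ℕ} {ψ₀ ψ₁ : SpinFoam.TopspinNetwork G n}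
          (Ψ : SpinFoam.TopspinFoam ψ₀ ψ₁),
            σ t f Ψ.arrow = M.normAmplitude Ψ ^ (Complex.I * t) * f Ψ.arrow) ∧
        SpinFoam.IsTimeEvolution σ) := by
  refine ⟨fun Ψ₁ Ψ₂ Ψ h h₁ h₂ => M.normAmplitude_of_isGluing hω h h₁ h₂, fun hM =>
    ⟨M.evolution, fun t f n ψ₀ ψ₁ Ψ => ?_, M.isTimeEvolution_evolution hω hM⟩⟩
  rw [M.evolution_apply, M.arrowAmplitude_arrow]
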